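/- **Setting.** Let $\mathcal A=M_d(\mathbb C)$ and let $\omega$ be a pure translation-invariant state of the quantum spin chain $\mathcal A_{\mathbb Z}$ (the quasi-local algebra with one copy of $\mathcal A$ at each site of $\mathbb Z$), where pure means extreme in the convex set of all states. Write $\rho_{[1,n]}$ for its density matrix on the sites $1,\dots,n$. Suppose that $\omega$ is finitely correlated with memory $\mathcal B=M_b(\mathbb C)$: there are a linear map $V:\mathbb C^d\otimes\mathbb C^b\to\mathbb C^b$ with $VV^\dagger=\mathbf 1$ and a non-singular $b\times b$ density matrix $\rho$ such that, with $\mathbb E(X)=VXV^\dagger$ and $\hat{\mathbb E}(B)=\mathbb E(\mathbf 1\otimes B)$, the matrix $\rho$ is the unique density matrix with $\operatorname{Tr}\rho\,\hat{\mathbb E}(B)=\operatorname{Tr}\rho B$ for all $B\in\mathcal B$, and $$\operatorname{Tr}\bigl(\rho_{[1,n]}\,A_1\otimes\cdots\otimes A_n\bigr)=\operatorname{Tr}\bigl(\rho\,\mathbb E(A_1\otimes\mathbb E(A_2\otimes\cdots\mathbb E(A_n\otimes\mathbf 1)\cdots))\bigr)$$ for all $n$ and all $A_1,\dots,A_n\in\mathcal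 A$. Let $\rho_{\mathcal A\otimes\mathcal B}=V^\dagger\rho V$, that is, $\operatorname{Tr}(\rho_{\mathcal A\otimes\mathcal B}X)=\operatorname{Tr}(\rho\,\mathbb E(X))$ for all $X\in\mathcal A\otimes\mathcal B$. For a bipartite density matrix $\sigma$ on $\mathcal X_1\otimes\mathcal X_2$, let $$\mathrm{EoF}(\sigma)=\inf\sum_i p_i\,S\bigl(\operatorname{Tr}_{\mathcal X_2}\sigma_i\bigr),\qquad S(\tau)=-\operatorname{Tr}\tau\log\tau,$$ with the infimum over all finite convex decompositions $\sigma=\sum_i p_i\sigma_i$ into pure states. Call $\sigma$ entangled if it is not a finite convex combination of product density matrices. Regard $\rho_{[1,n]}$ as a bipartite state of spin $1$ and the spins $2,\dots,n$, i.e. on $\mathcal A\otimes\mathcal A^{\otimes (n-1)}$, and $\rho_{\mathcal A\otimes\mathcal B}$ as a bipartite state on $\mathcal A\otimes\mathcal B$. **Theorem.** There are constants $c>0$ and $0<r<1$ such that for all $n\ge 1$ $$0\le \mathrm{EoF}(\rho_{\mathcal A\otimes\mathcal B})-\mathrm{EoF}(\rho_{[1,n]})\le c\,r^n .$$ Moreover,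 the following are equivalent: (i) $\rho_{\mathcal A\otimes\mathcal B}$ is entangled; (ii) $\rho_{[1,n]}$ is entangled for all sufficiently large $n$; (iii) $\rho_{[1,n]}$ is entangled for some $n\ge1$. -/

import Mathlib

open scoped Matrix Kronecker ComplexOrder

noncomputable section

namespace SpinChain

/-! ### Density matrices, entropy, entanglement -/

/-- A density matrix: positive semidefinite of trace one. -/
def IsDensityMatrix {α : Type*} [Fintype α] (σ : Matrix α α ℂ) : Prop :=
  σ.PosSemidef ∧ σ.trace = 1

/-- The partial trace over the second tensor factor. -/
def partialTraceRight {α β : Type*} [Fintype β] (M : Matrix (α × β) (α × β) ℂ) :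
    Matrix α α ℂ :=
  Matrix.of fun i j => ∑ k, M (i, k) (j, k)

/-- The von Neumann entropy `S(σ) = - Tr σ log σ` (natural logarithm, `0 log 0 = 0`), as the
trace of `η(σ)` with `η(x) = - x log x` applied through the functional calculus. -/
def vonNeumannEntropy {α : Type*} [Fintype α] [DecidableEq α] (σ : Matrix α α ℂ) : ℝ :=
  (cfc Real.negMulLog σ).trace.re

/-- `σ = ∑ i, p i • |φ i⟩⟨φ i|` is a convex decomposition of `σ` into pure states. -/
structure IsPureDecomposition {γ : Type*} [Fintype γ] (σ : Matrix γ γ ℂ) {k : ℕ}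
    (p : Fin k → ℝ) (φ : Fin k → γ → ℂ) : Prop where
  nonneg : ∀ i, 0 ≤ p i
  sum_eq_one : ∑ i, p i = 1
  unit : ∀ i, star (φ i) ⬝ᵥ φ i = 1
  decomp : σ = ∑ i, p i • Matrix.vecMulVec (φ i) (star (φ i))

/-- The entanglement of formation of a bipartite state `σ`: the infimum, over all convex
decompositions of `σ` into pure states, of the average entropy of the restrictions of these pure
states to the first factor. -/
def entanglementOfFormation {α β : Type*} [Fintype α] [DecidableEq α] [Fintype β]
    (σ : Matrix (α × β) (α × β) ℂ) : ℝ :=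
  sInf {s : ℝ | ∃ (k : ℕ) (p : Fin k → ℝ) (φ : Fin k → α × β → ℂ),
    IsPureDecomposition σ p φ ∧
      s = ∑ i, p i * vonNeumannEntropy
        (partialTraceRight (Matrix.vecMulVec (φ i) (star (φ i))))}

/-- A bipartite state is separable if it is a convex combination of product states. -/
def IsSeparable {α β : Type*} [Fintype α] [Fintype β]
    (σ : Matrix (α × β) (α × β) ℂ) : Prop :=
  ∃ (k : ℕ) (p : Fin k → ℝ) (μ : Fin k → Matrix α α ℂ) (ν : Fin k → Matrix β β ℂ),
    (∀ i, 0 ≤ p i) ∧ ∑ i, p i = 1 ∧ (∀ i, IsDensityMatrix (μ i)) ∧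
      (∀ i, IsDensityMatrix (ν i)) ∧ σ = ∑ i, p i • (μ i ⊗ₖ ν i)

/-- A bipartite state is entangled if it is not separable. -/
def IsEntangled {α β : Type*} [Fintype α] [Fintype β]
    (σ : Matrix (α × β) (α × β) ℂ) : Prop :=
  IsDensityMatrix σ ∧ ¬ IsSeparable σ

/-! ### States of the infinite chain -/

/-- A family of matrices attached to the finite intervals of `ℤ`: the matrix at `m`, `n` belongs
to the `n` consecutive sites `m, m + 1, …, m + n - 1`, each of them with the algebra of `d × d`
complex matrices; the `i`-th tensor factor (`i : Fin n`) sits at site `m + i`. -/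
abbrev LocalFamily (d : ℕ) : Type :=
  ℤ → (n : ℕ) → Matrix (Fin n → Fin d) (Fin n → Fin d) ℂ

/-- The states of the quasi-local algebra of the chain. The union of the algebras of the finite
intervals is dense in it, so a state is the same thing as a family of density matrices, one for
each finite interval, that is consistent under the partial trace over the last and over the first
site of an interval. -/
def chainStates (d : ℕ) : Set (LocalFamily d) :=
  {ω | (∀ m n, IsDensityMatrix (ω m n)) ∧
    (∀ m n (x y : Fin n → Fin d),
      ∑ s : Fin d, ω m (n + 1) (Fin.snoc x s) (Fin.snoc y s) = ω m n x y) ∧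
    (∀ m n (x y : Fin n → Fin d),
      ∑ s : Fin d, ω m (n + 1) (Fin.cons s x) (Fin.cons s y) = ω (m + 1) n x y)}

/-- A pure state of the chain: an extreme point of the convex set of all states. -/
def IsPureChainState {d : ℕ} (ω : LocalFamily d) : Prop :=
  ω ∈ (chainStates d).extremePoints ℝ

/-- Translation invariance. -/
def IsTranslationInvariant {d : ℕ} (ω : LocalFamily d) : Prop :=
  ∀ (m : ℤ) (n : ℕ), ω (m + 1) n = ω m n

/-- A matrix on `n + 1` sites as a matrix of the bipartite system that consists of the first site
and of the remaining `n` sites. -/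
def splitFirst {d n : ℕ} (M : Matrix (Fin (n + 1) → Fin d) (Fin (n + 1) → Fin d) ℂ) :
    Matrix (Fin d × (Fin n → Fin d)) (Fin d × (Fin n → Fin d)) ℂ :=
  M.submatrix (fun q => Fin.cons q.1 q.2) (fun q => Fin.cons q.1 q.2)

/-- The elementary tensor `A 0 ⊗ A 1 ⊗ ⋯ ⊗ A (n - 1)`. -/
def elementaryTensor {d n : ℕ} (A : Fin n → Matrix (Fin d) (Fin d) ℂ) :
    Matrix (Fin n → Fin d) (Fin n → Fin d) ℂ :=
  Matrix.of fun x y => ∏ i, A i (x i) (y i)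

/-! ### Finitely correlated states -/

/-- The map `𝔼(X) = V X V†` from the `(d b) × (d b)` matrices to the `b × b` matrices. -/
def transferMap {d b : ℕ} (V : Matrix (Fin b) (Fin d × Fin b) ℂ)
    (X : Matrix (Fin d × Fin b) (Fin d × Fin b) ℂ) : Matrix (Fin b) (Fin b) ℂ :=
  V * X * Vᴴ

/-- The map `Ê(B) = 𝔼(1 ⊗ B)`. -/
def reducedTransferMap {d b : ℕ} (V : Matrix (Fin b) (Fin d × Fin b) ℂ)
    (B : Matrix (Fin b) (Fin b) ℂ) : Matrix (Fin b) (Fin b) ℂ :=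
  transferMap V ((1 : Matrix (Fin d) (Fin d) ℂ) ⊗ₖ B)

/-- The nested expression `𝔼(A 0 ⊗ 𝔼(A 1 ⊗ ⋯ 𝔼(A (n - 1) ⊗ 1) ⋯ ))`. -/
def iteratedTransfer {d b : ℕ} (V : Matrix (Fin b) (Fin d × Fin b) ℂ) :
    (n : ℕ) → (Fin n → Matrix (Fin d) (Fin d) ℂ) → Matrix (Fin b) (Fin b) ℂ
  | 0, _ => 1
  | n + 1, A => transferMap V (A 0 ⊗ₖ iteratedTransfer V n (fun i => A i.succ))

/-- The `b × b` matrix `σ` satisfies `Tr σ Ê(B) = Tr σ B` for all `B`. -/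
def IsInvariant {d b : ℕ} (V : Matrix (Fin b) (Fin d × Fin b) ℂ)
    (σ : Matrix (Fin b) (Fin b) ℂ) : Prop :=
  ∀ B : Matrix (Fin b) (Fin b) ℂ, (σ * reducedTransferMap V B).trace = (σ * B).trace

/-- The pair `(V, ρ)`, with memory the algebra of `b × b` matrices, generates the finitely
correlated state `ω`: `V V† = 1`, the non-singular density matrix `ρ` is the unique invariant
density matrix, and the expectations of `ω` in the sites `1, …, n` are the ones obtained by
iterating `𝔼`. -/
structure Generates {d b : ℕ} (V : Matrix (Fin b) (Fin d × Fin b) ℂ)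
    (ρ : Matrix (Fin b) (Fin b) ℂ) (ω : LocalFamily d) : Prop where
  coisometry : V * Vᴴ = 1
  density : IsDensityMatrix ρ
  nonsingular : IsUnit ρ.det
  invariant : IsInvariant V ρ
  unique : ∀ σ : Matrix (Fin b) (Fin b) ℂ, IsDensityMatrix σ → IsInvariant V σ → σ = ρ
  expectation : ∀ (n : ℕ) (A : Fin n → Matrix (Fin d) (Fin d) ℂ),
    (ω 1 n * elementaryTensor A).trace = (ρ * iteratedTransfer V n A).trace

/-- The density matrix `ρ_{A ⊗ B} = V† ρ V` of one spin and the memory. -/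
def spinMemoryState {d b : ℕ} (V : Matrix (Fin b) (Fin d × Fin b) ℂ)
    (ρ : Matrix (Fin b) (Fin b) ℂ) : Matrix (Fin d × Fin b) (Fin d × Fin b) ℂ :=
  Vᴴ * ρ * V

/-- The defining property of `ρ_{A ⊗ B}`: `Tr (ρ_{A ⊗ B} X) = Tr (ρ 𝔼(X))`. -/
theorem trace_spinMemoryState_mul {d b : ℕ} (V : Matrix (Fin b) (Fin d × Fin b) ℂ)
    (ρ : Matrix (Fin b) (Fin b) ℂ) (X : Matrix (Fin d × Fin b) (Fin d × Fin b) ℂ) :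
    (spinMemoryState V ρ * X).trace = (ρ * transferMap V X).trace := by
  unfold spinMemoryState transferMap
  rw [Matrix.mul_assoc, Matrix.mul_assoc, Matrix.trace_mul_comm]
  simp only [Matrix.mul_assoc]

end SpinChain

end

/-!
# Entanglement of a spin with the rest of the chain in finitely correlated states

Write `A s` for the blocks of `V`, `A_x` for their product along a word `x`, and
`Φ(B) = ∑ s, A s B (A s)†`, so that the state of `n` spins has the entries `Tr(ρ A_y A_x†)`.

The spins `2, …, n + 1` are obtained from the memory by a channel with the Kraus operators
`encodingKraus`, whose columns together form the operator `Γ = encoding` from two copies of the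
memory to `n` spins (`splitFirst_wordState`). Conversely, if `Γ` is injective, its left inverse
followed by a root of `1 ⊗ ρᵀ` recovers the spin-memory state *exactly* from the state of
`n + 1` spins (`exists_recovery`). The Kraus operators of the recovery satisfy `∑ L† L ≤ κ` as
soon as `1 ⊗ ρᵀ ≤ κ Γ† Γ`, and `Γ† Γ → 1 ⊗ ρᵀ` exponentially fast when `Φⁿ` converges to
`B ↦ Tr(ρ B) 1`, so that one can take `κ = 1 + O(rⁿ)`.

An operation on the second factor with `∑ K† K ≤ κ` maps separable states to separable states,
and increases the entanglement of formation at most by the factor `κ`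
(`entanglementOfFormation_le_mul`). The latter is concavity of the entropy, applied to each
vector of a pure decomposition. With `κ = 1` this gives `EoF(spins) ≤ EoF(spin, memory)`, and
with the recovery it gives `EoF(spin, memory) ≤ (1 + O(rⁿ)) EoF(spins)`. No continuity estimate
for the entropy is needed, and the statements on separability are exact for large `n`.

It remains to see that a pure state has no peripheral eigenvalue of `Φ` besides `1`
(`IsErgodicKraus.eq_one_of_pure`). Peripheral eigenvectors are multiples of unitaries that
intertwine the Kraus operators up to a phase, and the peripheral eigenvalues form a finite,
hence cyclic, group; let `U` belong to a generator `z`. If `z ≠ 1`, then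
`ρ ± (c U ρ + c̄ ρ U†) / 2` are positive and generate two states of the chain with mean `ω`, so
purity yields `Tr(ρ U A_x A_y†) = 0` for all words of equal length. This is impossible:
`Φⁿ(B - U B U†) → 0` because all peripheral eigenvectors commute with `U`, and then an exchange
identity (`sum_trace_mul_krausMap_pow_single`) shows that `Tr(ρ Φⁿ(B) Φⁿ(B)†)` tends to zero for
the diagonal matrix units `B`, against the Cauchy-Schwarz inequality
(`IsErgodicKraus.false_of_trace_word_eq_zero`).
-/

noncomputable section

namespace SpinChain

open Matrix

/-! ### Density matrices -/

section Density

variable {α : Type*} [Fintype α]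

theorem IsDensityMatrix.nonempty {σ : Matrix α α ℂ} (h : IsDensityMatrix σ) : Nonempty α := by
  by_contra hne
  rw [not_nonempty_iff] at hne
  have := h.2
  simp [trace] at this

theorem isDensityMatrix_vecMulVec {u : α → ℂ} (hu : star u ⬝ᵥ u = 1) :
    IsDensityMatrix (vecMulVec u (star u)) :=
  ⟨posSemidef_vecMulVec_self_star u, by rw [trace_vecMulVec, dotProduct_comm, hu]⟩

theorem exists_unit_vector [Nonempty α] : ∃ u : α → ℂ, star u ⬝ᵥ u = 1 := by
  classical
  exact ⟨Pi.single (Classical.arbitrary α) 1, by simp⟩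

theorem exists_eq_smul_isDensityMatrix [Nonempty α] {N : Matrix α α ℂ} (hN : N.PosSemidef) :
    ∃ (t : ℝ) (D : Matrix α α ℂ), 0 ≤ t ∧ IsDensityMatrix D ∧ N = t • D := by
  obtain ⟨ht, hi⟩ := Complex.nonneg_iff.1 hN.trace_nonneg
  have htr : N.trace = (N.trace.re : ℂ) := Complex.ext rfl (by simp [← hi])
  rcases ht.eq_or_lt with h0 | h0
  · obtain ⟨u, hu⟩ := exists_unit_vector (α := α)
    refine ⟨0, _, le_rfl, isDensityMatrix_vecMulVec hu, ?_⟩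
    rw [zero_smul, ← hN.trace_eq_zero_iff, htr, ← h0, Complex.ofReal_zero]
  · refine ⟨N.trace.re, N.trace.re⁻¹ • N, ht, ⟨hN.smul (inv_nonneg.2 ht), ?_⟩, ?_⟩
    · rw [trace_smul, htr, Complex.real_smul, Complex.ofReal_re, ← Complex.ofReal_mul,
        inv_mul_cancel₀ h0.ne', Complex.ofReal_one]
    · rw [smul_smul, mul_inv_cancel₀ h0.ne', one_smul]

theorem exists_vecMulVec_eq_smul_unit [Nonempty α] (v : α → ℂ) :
    ∃ (q : ℝ) (u : α → ℂ), 0 ≤ q ∧ star u ⬝ᵥ u = 1 ∧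
      vecMulVec v (star v) = q • vecMulVec u (star u) := by
  obtain ⟨ht, hi⟩ := Complex.nonneg_iff.1 (dotProduct_star_self_nonneg v)
  set t := (star v ⬝ᵥ v).re with htdef
  have htr : star v ⬝ᵥ v = (t : ℂ) := Complex.ext rfl (by simp [← hi])
  rcases ht.eq_or_lt with h0 | h0
  · obtain ⟨u, hu⟩ := exists_unit_vector (α := α)
    refine ⟨0, u, le_rfl, hu, ?_⟩
    rw [← h0, Complex.ofReal_zero, dotProduct_star_self_eq_zero] at htr
    simp [htr]
  · have hs : (Real.sqrt t)⁻¹ * (Real.sqrt t)⁻¹ = t⁻¹ := by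
      rw [← mul_inv, Real.mul_self_sqrt ht]
    refine ⟨t, (Real.sqrt t)⁻¹ • v, ht, ?_, ?_⟩
    · rw [star_smul, star_trivial (Real.sqrt t)⁻¹, smul_dotProduct, dotProduct_smul, smul_smul, hs,
        htr, Complex.real_smul, ← Complex.ofReal_mul, inv_mul_cancel₀ h0.ne', Complex.ofReal_one]
    · rw [star_smul, star_trivial (Real.sqrt t)⁻¹, smul_vecMulVec, vecMulVec_smul, smul_smul,
        smul_smul, mul_assoc, hs, mul_inv_cancel₀ h0.ne', one_smul]

end Density

/-! ### Concavity of the von Neumann entropy -/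

section Entropy

variable {α : Type*} [Fintype α] [DecidableEq α]

theorem vonNeumannEntropy_eq_sum_eigenvalues {σ : Matrix α α ℂ} (h : σ.IsHermitian) :
    vonNeumannEntropy σ = ∑ i, Real.negMulLog (h.eigenvalues i) := by
  unfold vonNeumannEntropy
  rw [h.cfc_eq, IsHermitian.cfc, Unitary.conjStarAlgAut_apply, trace_mul_cycle,
    Unitary.coe_star_mul_self, one_mul, trace_diagonal]
  simp

theorem IsDensityMatrix.eigenvalues_le_one {σ : Matrix α α ℂ} (h : IsDensityMatrix σ) (i : α) :
    h.1.1.eigenvalues i ≤ 1 := by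
  have hs : ∑ i, h.1.1.eigenvalues i = 1 := by
    have := h.2.symm.trans h.1.1.trace_eq_sum_eigenvalues
    exact Complex.ofReal_injective (by simpa using this.symm)
  rw [← hs]
  exact Finset.single_le_sum (f := fun i => h.1.1.eigenvalues i)
    (fun j _ => h.1.eigenvalues_nonneg j) (Finset.mem_univ i)

theorem IsDensityMatrix.vonNeumannEntropy_nonneg {σ : Matrix α α ℂ} (h : IsDensityMatrix σ) :
    0 ≤ vonNeumannEntropy σ := by
  rw [vonNeumannEntropy_eq_sum_eigenvalues h.1.1]
  exact Finset.sum_nonneg fun i _ =>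
    Real.negMulLog_nonneg (h.1.eigenvalues_nonneg i) (h.eigenvalues_le_one i)

theorem sum_normSq_row_unitary (U : unitaryGroup α ℂ) (i : α) :
    ∑ k, Complex.normSq ((U : Matrix α α ℂ) i k) = 1 := by
  have h := congrFun (congrFun (Unitary.coe_mul_star_self U) i) i
  rw [mul_apply, one_apply_eq] at h
  have h2 : ((∑ k, Complex.normSq ((U : Matrix α α ℂ) i k) : ℝ) : ℂ) = 1 := by
    rw [← h]
    push_cast
    exact Finset.sum_congr rfl fun k _ => by
      rw [star_apply, Complex.normSq_eq_conj_mul_self, mul_comm]; rfl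
  exact_mod_cast h2

theorem sum_normSq_col_unitary (U : unitaryGroup α ℂ) (k : α) :
    ∑ i, Complex.normSq ((U : Matrix α α ℂ) i k) = 1 := by
  rw [← sum_normSq_row_unitary (star U) k]
  exact Finset.sum_congr rfl fun i _ => by simp [star_apply]

/-- The diagonal of a matrix in an orthonormal basis (the columns of `U`) in terms of its
eigenvalues. -/
theorem conj_unitary_diag_eq {σ : Matrix α α ℂ} (h : σ.IsHermitian) (U : unitaryGroup α ℂ)
    (i : α) :
    ((star (U : Matrix α α ℂ) * σ * (U : Matrix α α ℂ)) i i).re =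
      ∑ k, Complex.normSq ((star U * h.eigenvectorUnitary : unitaryGroup α ℂ).1 i k) *
        h.eigenvalues k := by
  have e : star (U : Matrix α α ℂ) * σ * (U : Matrix α α ℂ) =
      (star U * h.eigenvectorUnitary : unitaryGroup α ℂ).1 *
        diagonal (RCLike.ofReal ∘ h.eigenvalues) *
        star (star U * h.eigenvectorUnitary : unitaryGroup α ℂ).1 := by
    conv_lhs => rw [h.spectral_theorem, Unitary.conjStarAlgAut_apply]
    simp [mul_assoc, star_mul]
  rw [e, mul_apply, Complex.re_sum]
  refine Finset.sum_congr rfl fun k _ => ?_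
  rw [mul_diagonal, star_apply, mul_right_comm]
  have : ∀ z : ℂ, z * star z = (Complex.normSq z : ℂ) := fun z => Complex.mul_conj z
  rw [this]
  simp

/-- Peierls' inequality: the entropy is at most the Shannon entropy of the diagonal in any
orthonormal basis. -/
theorem vonNeumannEntropy_le_sum_diag {σ : Matrix α α ℂ} (h : σ.PosSemidef)
    (U : unitaryGroup α ℂ) :
    vonNeumannEntropy σ ≤
      ∑ i, Real.negMulLog ((star (U : Matrix α α ℂ) * σ * (U : Matrix α α ℂ)) i i).re := by
  rw [vonNeumannEntropy_eq_sum_eigenvalues h.1]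
  set W := (star U * h.1.eigenvectorUnitary : unitaryGroup α ℂ) with hW
  calc ∑ k, Real.negMulLog (h.1.eigenvalues k)
      = ∑ i, ∑ k, Complex.normSq (W.1 i k) * Real.negMulLog (h.1.eigenvalues k) := by
        rw [Finset.sum_comm]
        refine Finset.sum_congr rfl fun k _ => ?_
        rw [← Finset.sum_mul, sum_normSq_col_unitary, one_mul]
    _ ≤ _ := by
        refine Finset.sum_le_sum fun i _ => ?_
        rw [conj_unitary_diag_eq h.1]
        exact Real.concaveOn_negMulLog.le_map_sum (fun k _ => Complex.normSq_nonneg _)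
          (sum_normSq_row_unitary W i) fun k _ => h.eigenvalues_nonneg k

theorem vonNeumannEntropy_concave {ι : Type*} [Fintype ι] {w : ι → ℝ} {D : ι → Matrix α α ℂ}
    (hw : ∀ j, 0 ≤ w j) (hw1 : ∑ j, w j = 1) (hD : ∀ j, (D j).PosSemidef) :
    ∑ j, w j * vonNeumannEntropy (D j) ≤ vonNeumannEntropy (∑ j, w j • D j) := by
  have hτ : (∑ j, w j • D j).PosSemidef := posSemidef_sum _ fun j _ => (hD j).smul (hw j)
  set U := hτ.1.eigenvectorUnitary with hU
  have hl : ∀ i, hτ.1.eigenvalues i =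
      ∑ j, w j * ((star (U : Matrix α α ℂ) * D j * (U : Matrix α α ℂ)) i i).re := by
    intro i
    have h1 := conj_unitary_diag_eq hτ.1 U i
    have h2 : (star U * hτ.1.eigenvectorUnitary : unitaryGroup α ℂ) = 1 := by simp [hU]
    rw [h2] at h1
    have h3 : ∑ k, Complex.normSq ((1 : unitaryGroup α ℂ).1 i k) * hτ.1.eigenvalues k =
        hτ.1.eigenvalues i := by
      rw [Finset.sum_eq_single i] <;> simp +contextual [one_apply, eq_comm]
    rw [h3] at h1
    rw [← h1, Finset.mul_sum, Finset.sum_mul, Matrix.sum_apply, Complex.re_sum]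
    refine Finset.sum_congr rfl fun j _ => ?_
    rw [mul_smul_comm, smul_mul_assoc, Matrix.smul_apply, Complex.smul_re, smul_eq_mul]
  rw [vonNeumannEntropy_eq_sum_eigenvalues hτ.1]
  calc ∑ j, w j * vonNeumannEntropy (D j)
      ≤ ∑ j, w j * ∑ i, Real.negMulLog
          ((star (U : Matrix α α ℂ) * D j * (U : Matrix α α ℂ)) i i).re :=
        Finset.sum_le_sum fun j _ =>
          mul_le_mul_of_nonneg_left (vonNeumannEntropy_le_sum_diag (hD j) U) (hw j)
    _ = ∑ i, ∑ j, w j * Real.negMulLog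
          ((star (U : Matrix α α ℂ) * D j * (U : Matrix α α ℂ)) i i).re := by
        simp_rw [Finset.mul_sum]
        exact Finset.sum_comm
    _ ≤ _ := by
        refine Finset.sum_le_sum fun i _ => ?_
        rw [hl]
        refine Real.concaveOn_negMulLog.le_map_sum (fun j _ => hw j) hw1 fun j _ => ?_
        have := ((hD j).conjTranspose_mul_mul_same (U : Matrix α α ℂ)).diag_nonneg (i := i)
        exact (Complex.nonneg_iff.1 this).1

/-- If the ensemble `∑ j, q j • D j` is dominated by `κ • τ`, its average entropy is at most
`κ S(τ)`. This is concavity of the entropy, the defect `κ • τ - ∑ j, q j • D j` contributing a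
nonnegative term. -/
theorem sum_mul_vonNeumannEntropy_le {ι : Type*} [Fintype ι] {q : ι → ℝ} {D : ι → Matrix α α ℂ}
    {τ : Matrix α α ℂ} {κ : ℝ} (hκ : 0 < κ) (hτ : IsDensityMatrix τ)
    (hq : ∀ j, 0 ≤ q j) (hD : ∀ j, IsDensityMatrix (D j))
    (hle : (κ • τ - ∑ j, q j • D j).PosSemidef) :
    ∑ j, q j * vonNeumannEntropy (D j) ≤ κ * vonNeumannEntropy τ := by
  set ξ := κ • τ - ∑ j, q j • D j with hξ
  have htr : ξ.trace = ((κ - ∑ j, q j : ℝ) : ℂ) := by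
    simp [hξ, trace_sub, trace_sum, trace_smul, hτ.2, (hD _).2]
  have : Nonempty α := hτ.nonempty
  obtain ⟨x, D₀, hx0, hD₀, hξD⟩ := exists_eq_smul_isDensityMatrix hle
  have hx : κ - ∑ j, q j = x := by
    rw [hξD, trace_smul, hD₀.2, Complex.real_smul, mul_one] at htr
    exact_mod_cast htr.symm
  rw [← hx] at hx0 hξD
  have key := vonNeumannEntropy_concave (ι := Option ι)
    (w := fun o => o.elim ((κ - ∑ j, q j) / κ) fun j => q j / κ)
    (D := fun o => o.elim D₀ D)
    (by rintro (_ | j); exacts [div_nonneg hx0 hκ.le, div_nonneg (hq j) hκ.le])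
    (by
      rw [Fintype.sum_option]
      simp only [Option.elim]
      rw [← Finset.sum_div, ← add_div, sub_add_cancel, div_self hκ.ne'])
    (by rintro (_ | j); exacts [hD₀.1, (hD j).1])
  have hsum : ∑ o : Option ι, (o.elim ((κ - ∑ j, q j) / κ) fun j => q j / κ : ℝ) •
      (o.elim D₀ D : Matrix α α ℂ) = τ := by
    rw [Fintype.sum_option]
    simp only [Option.elim]
    have h1 : ((κ - ∑ j, q j) / κ) • D₀ = κ⁻¹ • ξ := by
      rw [hξD, smul_smul, div_eq_inv_mul]
    have h2 : ∑ j, (q j / κ) • D j = κ⁻¹ • ∑ j, q j • D j := by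
      rw [Finset.smul_sum]
      exact Finset.sum_congr rfl fun j _ => by rw [smul_smul, div_eq_inv_mul]
    rw [h1, h2, ← smul_add, hξ, sub_add_cancel, smul_smul, inv_mul_cancel₀ hκ.ne', one_smul]
  rw [hsum, Fintype.sum_option] at key
  simp only [Option.elim] at key
  have h0 : 0 ≤ (κ - ∑ j, q j) / κ * vonNeumannEntropy D₀ :=
    mul_nonneg (div_nonneg hx0 hκ.le) hD₀.vonNeumannEntropy_nonneg
  have h1 : ∑ j, q j / κ * vonNeumannEntropy (D j) =
      (∑ j, q j * vonNeumannEntropy (D j)) / κ := by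
    rw [Finset.sum_div]
    exact Finset.sum_congr rfl fun j _ => by ring
  rw [h1] at key
  rw [← div_le_iff₀' hκ]
  linarith

end Entropy

/-! ### Local operations on the second factor -/

section LocalOperations

variable {α β γ : Type*} [Fintype β]

theorem partialTraceRight_vecMulVec (ψ : α × β → ℂ) :
    partialTraceRight (vecMulVec ψ (star ψ)) =
      (Matrix.of fun i k => ψ (i, k)) * (Matrix.of fun i k => ψ (i, k))ᴴ := by
  ext i j
  simp [partialTraceRight, mul_apply, vecMulVec_apply]

theorem partialTraceRight_smul (r : ℝ) (M : Matrix (α × β) (α × β) ℂ) :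
    partialTraceRight (r • M) = r • partialTraceRight M := by
  ext i j
  simp [partialTraceRight, Finset.mul_sum]

variable [Fintype α] [Fintype γ]

theorem trace_partialTraceRight (M : Matrix (α × β) (α × β) ℂ) :
    (partialTraceRight M).trace = M.trace := by
  simp [partialTraceRight, trace, Fintype.sum_prod_type]

theorem isDensityMatrix_partialTraceRight {u : α × β → ℂ} (hu : star u ⬝ᵥ u = 1) :
    IsDensityMatrix (partialTraceRight (vecMulVec u (star u))) := by
  refine ⟨?_, ?_⟩
  · rw [partialTraceRight_vecMulVec]
    exact posSemidef_self_mul_conjTranspose _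
  · rw [trace_partialTraceRight, (isDensityMatrix_vecMulVec hu).2]

theorem mul_vecMulVec_mul_conjTranspose {m n : Type*} [Fintype m] [Fintype n]
    (T : Matrix m n ℂ) (v : n → ℂ) :
    T * vecMulVec v (star v) * Tᴴ = vecMulVec (T *ᵥ v) (star (T *ᵥ v)) := by
  rw [mul_vecMulVec, vecMulVec_mul, star_mulVec]

variable [DecidableEq α]

theorem partialTraceRight_vecMulVec_one_kronecker (K : Matrix γ β ℂ) (ψ : α × β → ℂ) :
    partialTraceRight (vecMulVec (((1 : Matrix α α ℂ) ⊗ₖ K) *ᵥ ψ)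
        (star (((1 : Matrix α α ℂ) ⊗ₖ K) *ᵥ ψ))) =
      (Matrix.of fun i k => ψ (i, k)) * (Kᴴ * K)ᵀ * (Matrix.of fun i k => ψ (i, k))ᴴ := by
  have h : (Matrix.of fun i k => (((1 : Matrix α α ℂ) ⊗ₖ K) *ᵥ ψ) (i, k)) =
      (Matrix.of fun i k => ψ (i, k)) * Kᵀ := by
    ext i k
    simp [mulVec, dotProduct, mul_apply, Fintype.sum_prod_type, one_apply, mul_comm]
  rw [partialTraceRight_vecMulVec, h, conjTranspose_mul, transpose_mul]
  simp only [Matrix.mul_assoc]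
  rfl

variable {ι : Type*} [Fintype ι]

/-- Entropies of the restrictions to the first factor under a local operation on the second factor:
the restrictions of the (subnormalised) branches are dominated by `κ` times the original one. -/
theorem sum_mul_entropy_branches_le [DecidableEq β] {K : ι → Matrix γ β ℂ} {κ : ℝ} (hκ : 0 < κ)
    (hK : (κ • (1 : Matrix β β ℂ) - ∑ j, (K j)ᴴ * K j).PosSemidef)
    {φ : α × β → ℂ} (hφ : star φ ⬝ᵥ φ = 1) {q : ι → ℝ} {u : ι → α × γ → ℂ}
    (hq : ∀ j, 0 ≤ q j) (hu : ∀ j, star (u j) ⬝ᵥ u j = 1)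
    (hqu : ∀ j, vecMulVec (((1 : Matrix α α ℂ) ⊗ₖ K j) *ᵥ φ)
      (star (((1 : Matrix α α ℂ) ⊗ₖ K j) *ᵥ φ)) = q j • vecMulVec (u j) (star (u j))) :
    ∑ j, q j * vonNeumannEntropy (partialTraceRight (vecMulVec (u j) (star (u j)))) ≤
      κ * vonNeumannEntropy (partialTraceRight (vecMulVec φ (star φ))) := by
  refine sum_mul_vonNeumannEntropy_le hκ (isDensityMatrix_partialTraceRight hφ) hq
    (fun j => isDensityMatrix_partialTraceRight (hu j)) ?_
  have h1 : ∑ j, q j • partialTraceRight (vecMulVec (u j) (star (u j))) =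
      (Matrix.of fun i k => φ (i, k)) * (∑ j, (K j)ᴴ * K j)ᵀ *
        (Matrix.of fun i k => φ (i, k))ᴴ := by
    rw [transpose_sum, Matrix.mul_sum, Matrix.sum_mul]
    refine Finset.sum_congr rfl fun j _ => ?_
    rw [← partialTraceRight_smul, ← hqu, partialTraceRight_vecMulVec_one_kronecker]
  have h2 := hK.transpose.mul_mul_conjTranspose_same (Matrix.of fun i k => φ (i, k))
  rw [transpose_sub, transpose_smul, transpose_one, Matrix.mul_sub, Matrix.sub_mul,
    Matrix.mul_smul, Matrix.smul_mul, Matrix.mul_one] at h2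
  rw [h1, partialTraceRight_vecMulVec]
  exact h2

end LocalOperations

/-! ### Entanglement of formation -/

section EoF

variable {α β γ : Type*} [Fintype α] [DecidableEq α] [Fintype β] [Fintype γ]

theorem IsPureDecomposition.sum_entropy_nonneg {σ : Matrix (α × β) (α × β) ℂ} {k : ℕ}
    {p : Fin k → ℝ} {φ : Fin k → α × β → ℂ} (h : IsPureDecomposition σ p φ) :
    0 ≤ ∑ i, p i * vonNeumannEntropy (partialTraceRight (vecMulVec (φ i) (star (φ i)))) :=
  Finset.sum_nonneg fun i _ => mul_nonneg (h.nonneg i)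
    (isDensityMatrix_partialTraceRight (h.unit i)).vonNeumannEntropy_nonneg

theorem entanglementOfFormation_nonneg (σ : Matrix (α × β) (α × β) ℂ) :
    0 ≤ entanglementOfFormation σ := by
  refine Real.sInf_nonneg ?_
  rintro s ⟨k, p, φ, h, rfl⟩
  exact h.sum_entropy_nonneg

theorem entanglementOfFormation_le_of_decomposition {ι : Type*} [Fintype ι]
    {σ : Matrix (α × β) (α × β) ℂ} {p : ι → ℝ} {φ : ι → α × β → ℂ}
    (hp : ∀ i, 0 ≤ p i) (hp1 : ∑ i, p i = 1) (hφ : ∀ i, star (φ i) ⬝ᵥ φ i = 1)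
    (hσ : σ = ∑ i, p i • vecMulVec (φ i) (star (φ i))) :
    entanglementOfFormation σ ≤
      ∑ i, p i * vonNeumannEntropy (partialTraceRight (vecMulVec (φ i) (star (φ i)))) := by
  let e := (Fintype.equivFin ι).symm
  refine csInf_le ⟨0, ?_⟩ ⟨Fintype.card ι, p ∘ e, φ ∘ e, ⟨fun i => hp _, ?_, fun i => hφ _, ?_⟩, ?_⟩
  · rintro s ⟨k, p, φ, h, rfl⟩
    exact h.sum_entropy_nonneg
  · rw [← hp1]
    exact e.sum_comp p
  · rw [hσ]
    exact (e.sum_comp fun i => p i • vecMulVec (φ i) (star (φ i))).symm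
  · exact (e.sum_comp fun i => p i *
      vonNeumannEntropy (partialTraceRight (vecMulVec (φ i) (star (φ i))))).symm

/-- The spectral decomposition is a decomposition into pure states. -/
theorem IsDensityMatrix.exists_isPureDecomposition {δ : Type*} [Fintype δ]
    {σ : Matrix δ δ ℂ} (h : IsDensityMatrix σ) :
    ∃ (k : ℕ) (p : Fin k → ℝ) (φ : Fin k → δ → ℂ), IsPureDecomposition σ p φ := by
  classical
  let e := (Fintype.equivFin δ).symm
  set U := h.1.1.eigenvectorUnitary with hU
  refine ⟨Fintype.card δ, fun i => h.1.1.eigenvalues (e i), fun i x => (U : Matrix δ δ ℂ) x (e i),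
    fun i => h.1.eigenvalues_nonneg _, ?_, fun i => ?_, ?_⟩
  · rw [e.sum_comp h.1.1.eigenvalues]
    have := h.2.symm.trans h.1.1.trace_eq_sum_eigenvalues
    exact Complex.ofReal_injective (by simpa using this.symm)
  · have := congrFun (congrFun (Unitary.coe_star_mul_self U) (e i)) (e i)
    rw [one_apply_eq] at this
    rw [← this]
    rfl
  · rw [e.sum_comp fun i => h.1.1.eigenvalues i •
      vecMulVec (fun x => (U : Matrix δ δ ℂ) x i) (star fun x => (U : Matrix δ δ ℂ) x i)]
    conv_lhs => rw [h.1.1.spectral_theorem, Unitary.conjStarAlgAut_apply]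
    ext x y
    rw [mul_apply, Matrix.sum_apply]
    refine Finset.sum_congr rfl fun i _ => ?_
    rw [mul_diagonal, star_apply, Matrix.smul_apply, vecMulVec_apply, Function.comp_apply,
      Complex.real_smul, Pi.star_apply, mul_comm ((U : Matrix δ δ ℂ) x i), mul_assoc]
    rfl

/-- A local operation on the second factor whose Kraus operators satisfy `∑ Kⱼ† Kⱼ ≤ κ` increases
the entanglement of formation at most by the factor `κ`: it maps every pure decomposition of `σ` to
one of the image, and the entropies are controlled by concavity. -/
theorem entanglementOfFormation_le_mul [DecidableEq β] {ι : Type*} [Fintype ι]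
    {K : ι → Matrix γ β ℂ} {κ : ℝ} (hκ : 0 < κ)
    (hK : (κ • (1 : Matrix β β ℂ) - ∑ j, (K j)ᴴ * K j).PosSemidef)
    {σ : Matrix (α × β) (α × β) ℂ} {σ' : Matrix (α × γ) (α × γ) ℂ}
    (hσ : IsDensityMatrix σ) (hσ' : IsDensityMatrix σ')
    (h : σ' = ∑ j, ((1 : Matrix α α ℂ) ⊗ₖ K j) * σ * ((1 : Matrix α α ℂ) ⊗ₖ K j)ᴴ) :
    entanglementOfFormation σ' ≤ κ * entanglementOfFormation σ := by
  have : Nonempty (α × γ) := hσ'.nonempty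
  rw [← div_le_iff₀' hκ]
  refine le_csInf ?_ ?_
  · obtain ⟨k, p, φ, hd⟩ := hσ.exists_isPureDecomposition
    exact ⟨_, k, p, φ, hd, rfl⟩
  rintro s ⟨k, p, φ, hd, rfl⟩
  rw [div_le_iff₀' hκ]
  choose q u hq hu hqu using fun (i : Fin k) (j : ι) =>
    exists_vecMulVec_eq_smul_unit (((1 : Matrix α α ℂ) ⊗ₖ K j) *ᵥ φ i)
  have hdec : σ' = ∑ x : Fin k × ι, (p x.1 * q x.1 x.2) •
      vecMulVec (u x.1 x.2) (star (u x.1 x.2)) := by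
    rw [h, Fintype.sum_prod_type, Finset.sum_comm]
    refine Finset.sum_congr rfl fun j _ => ?_
    rw [hd.decomp, Matrix.mul_sum, Matrix.sum_mul]
    refine Finset.sum_congr rfl fun i _ => ?_
    rw [Matrix.mul_smul, Matrix.smul_mul, mul_vecMulVec_mul_conjTranspose, hqu, smul_smul]
  have hsum : ∑ x : Fin k × ι, p x.1 * q x.1 x.2 = 1 := by
    have := hσ'.2
    rw [hdec, trace_sum] at this
    simp only [trace_smul, (isDensityMatrix_vecMulVec (hu _ _)).2] at this
    simp only [Complex.real_smul, mul_one] at this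
    exact_mod_cast this
  refine (entanglementOfFormation_le_of_decomposition
    (fun x : Fin k × ι => mul_nonneg (hd.nonneg x.1) (hq x.1 x.2)) hsum
    (fun x => hu x.1 x.2) hdec).trans ?_
  rw [Fintype.sum_prod_type, Finset.mul_sum]
  refine Finset.sum_le_sum fun i _ => ?_
  have := sum_mul_entropy_branches_le hκ hK (hd.unit i) (hq i) (hu i) (hqu i)
  calc _ = p i * ∑ j, q i j *
        vonNeumannEntropy (partialTraceRight (vecMulVec (u i j) (star (u i j)))) := by
        rw [Finset.mul_sum]
        exact Finset.sum_congr rfl fun j _ => by ring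
    _ ≤ p i * (κ * vonNeumannEntropy (partialTraceRight (vecMulVec (φ i) (star (φ i))))) :=
        mul_le_mul_of_nonneg_left this (hd.nonneg i)
    _ = _ := by ring

/-- Separability is preserved by local operations on the second factor, trace preserving or not, as
long as the image is normalised. -/
theorem IsSeparable.map [DecidableEq β] {ι : Type*} [Fintype ι] {K : ι → Matrix γ β ℂ}
    {σ : Matrix (α × β) (α × β) ℂ} {σ' : Matrix (α × γ) (α × γ) ℂ}
    (hσ : IsSeparable σ) (hσ' : σ'.trace = 1)
    (h : σ' = ∑ j, ((1 : Matrix α α ℂ) ⊗ₖ K j) * σ * ((1 : Matrix α α ℂ) ⊗ₖ K j)ᴴ) :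
    IsSeparable σ' := by
  have hne : Nonempty γ := by
    by_contra hne
    rw [not_nonempty_iff] at hne
    simp [trace] at hσ'
  obtain ⟨k, p, μ, ν, hp, hp1, hμ, hν, hσ⟩ := hσ
  choose t D ht hD htD using fun i => exists_eq_smul_isDensityMatrix
    (posSemidef_sum Finset.univ fun (j : ι) _ => (hν i).1.mul_mul_conjTranspose_same (K j))
  have hdec : σ' = ∑ i, (p i * t i) • (μ i ⊗ₖ D i) := by
    rw [h, hσ]
    simp only [Matrix.mul_sum, Matrix.sum_mul]
    rw [Finset.sum_comm]
    refine Finset.sum_congr rfl fun i _ => ?_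
    rw [mul_smul, ← kronecker_smul (t i) (μ i) (D i), ← htD]
    simp only [Matrix.mul_smul, Matrix.smul_mul, ← Finset.smul_sum, conjTranspose_kronecker,
      conjTranspose_one, ← mul_kronecker_mul, Matrix.one_mul, Matrix.mul_one]
    congr 1
    ext ⟨a, b⟩ ⟨a', b'⟩
    simp [kroneckerMap_apply, Matrix.sum_apply, Finset.mul_sum]
  refine ⟨k, fun i => p i * t i, μ, D, fun i => mul_nonneg (hp i) (ht i), ?_, hμ, hD, hdec⟩
  rw [hdec, trace_sum] at hσ'
  simp only [trace_smul, trace_kronecker, (hμ _).2, (hD _).2] at hσ'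
  simp only [Complex.real_smul, mul_one] at hσ'
  exact_mod_cast hσ'

end EoF

/-! ### Powers of a linear map of spectral radius below one -/

section Decay

theorem exists_norm_apply_le {F : Type*} [NormedAddCommGroup F] [NormedSpace ℂ F]
    [FiniteDimensional ℂ F] (g : F →ₗ[ℂ] ℂ) : ∃ C : ℝ, 0 ≤ C ∧ ∀ x, ‖g x‖ ≤ C * ‖x‖ :=
  ⟨‖LinearMap.toContinuousLinearMap g‖, norm_nonneg _,
    (LinearMap.toContinuousLinearMap g).le_opNorm⟩

attribute [local instance] Matrix.linftyOpNormedRing Matrix.linftyOpNormedAlgebra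
  Matrix.linftyOpNormedAddCommGroup

theorem exists_norm_pow_le_of_spectrum {k : ℕ} (M : Matrix (Fin k) (Fin k) ℂ)
    (h : ∀ μ ∈ spectrum ℂ M, ‖μ‖ < 1) :
    ∃ r C : ℝ, 0 < r ∧ r < 1 ∧ ∀ n : ℕ, ‖M ^ n‖ ≤ C * r ^ n := by
  have : CompleteSpace (Matrix (Fin k) (Fin k) ℂ) := FiniteDimensional.complete ℂ _
  have hs : spectralRadius ℂ M < (1 : NNReal) := by
    by_cases hne : (spectrum ℂ M).Nonempty
    · exact spectrum.spectralRadius_lt_of_forall_lt_of_nonempty hne fun μ hμ => by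
        exact_mod_cast h μ hμ
    · rw [Set.not_nonempty_iff_eq_empty] at hne
      simp [spectralRadius, hne]
  obtain ⟨r, hr0, hr1⟩ := ENNReal.lt_iff_exists_nnreal_btwn.1 hs
  have hr1' : (r : ℝ) < 1 := by exact_mod_cast hr1
  have hrpos : 0 < (r : ℝ) := by
    have : (0 : ENNReal) < r := lt_of_le_of_lt zero_le hr0
    exact_mod_cast this
  have ht := (spectrum.pow_nnnorm_pow_one_div_tendsto_nhds_spectralRadius M).eventually_lt_const hr0
  obtain ⟨N, hN⟩ := Filter.eventually_atTop.1 ht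
  have hle : ∀ n, max N 1 ≤ n → ‖M ^ n‖ ≤ r ^ n := by
    intro n hn
    have h1 := hN n ((le_max_left _ _).trans hn)
    have hn0 : (n : ℝ) ≠ 0 := by
      have := (le_max_right N 1).trans hn
      positivity
    have h2 := ENNReal.rpow_le_rpow h1.le (Nat.cast_nonneg n : (0 : ℝ) ≤ n)
    rw [← ENNReal.rpow_mul, one_div, inv_mul_cancel₀ hn0, ENNReal.rpow_one,
      ENNReal.rpow_natCast] at h2
    exact_mod_cast h2
  refine ⟨r, 1 + ∑ m ∈ Finset.range (max N 1), ‖M ^ m‖ / r ^ m, hrpos, hr1', fun n => ?_⟩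
  have hpos : 0 ≤ ∑ m ∈ Finset.range (max N 1), ‖M ^ m‖ / (r : ℝ) ^ m :=
    Finset.sum_nonneg fun m _ => by positivity
  by_cases hn : max N 1 ≤ n
  · refine (hle n hn).trans ?_
    have : 0 < (r : ℝ) ^ n := by positivity
    nlinarith
  · have h1 := Finset.single_le_sum (f := fun m => ‖M ^ m‖ / (r : ℝ) ^ m)
      (fun m _ => by positivity) (Finset.mem_range.2 (not_le.1 hn))
    rw [← div_le_iff₀ (by positivity)]
    linarith

/-- If all eigenvalues of an endomorphism `L` of a finite-dimensional space lie in the open unit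
disc, the matrix coefficients of `L ^ n` decay exponentially, at a common rate. -/
theorem exists_pow_decay {E : Type*} [AddCommGroup E] [Module ℂ E] [FiniteDimensional ℂ E]
    (L : Module.End ℂ E) (h : ∀ μ, L.HasEigenvalue μ → ‖μ‖ < 1) :
    ∃ r : ℝ, 0 < r ∧ r < 1 ∧ ∀ (x : E) (f : E →ₗ[ℂ] ℂ), ∃ C : ℝ, ∀ n : ℕ,
      ‖f ((L ^ n) x)‖ ≤ C * r ^ n := by
  let e := LinearMap.toMatrixAlgEquiv (Module.finBasis ℂ E)
  obtain ⟨r, C, hr0, hr1, hC⟩ := exists_norm_pow_le_of_spectrum (e L) fun μ hμ => by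
    rw [AlgEquiv.spectrum_eq] at hμ
    exact h μ (Module.End.hasEigenvalue_iff_mem_spectrum.2 hμ)
  refine ⟨r, hr0, hr1, fun x f => ?_⟩
  let g : Matrix (Fin (Module.finrank ℂ E)) (Fin (Module.finrank ℂ E)) ℂ →ₗ[ℂ] ℂ :=
    f ∘ₗ LinearMap.applyₗ x ∘ₗ e.symm.toLinearMap
  obtain ⟨D, hD0, hD⟩ := exists_norm_apply_le g
  refine ⟨D * C, fun n => ?_⟩
  have h1 : f ((L ^ n) x) = g (e L ^ n) := by
    simp [g, ← map_pow]
  rw [h1, mul_assoc]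
  exact (hD _).trans (mul_le_mul_of_nonneg_left (hC n) hD0)

end Decay

/-! ### Unital completely positive maps with a unique faithful invariant state -/

theorem star_mul_self_eq_norm_sq (z : ℂ) : star z * z = ((‖z‖ ^ 2 : ℝ) : ℂ) := by
  rw [← Complex.normSq_eq_norm_sq, Complex.normSq_eq_conj_mul_self]; rfl

theorem star_mul_self_of_norm {z : ℂ} (h : ‖z‖ = 1) : star z * z = 1 := by
  rw [star_mul_self_eq_norm_sq, h]; simp

section Intertwines

variable {ι m : Type*} [Fintype m]

/-- `U` intertwines the adjoint Kraus operators with their multiples by `z`. -/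
def Intertwines (A : ι → Matrix m m ℂ) (z : ℂ) (U : Matrix m m ℂ) : Prop :=
  ∀ s, U * (A s)ᴴ = z • ((A s)ᴴ * U)

variable {A : ι → Matrix m m ℂ}

theorem Intertwines.mul {z w : ℂ} {U W : Matrix m m ℂ} (hU : Intertwines A z U)
    (hW : Intertwines A w W) : Intertwines A (z * w) (U * W) := fun s => by
  rw [Matrix.mul_assoc, hW s, Matrix.mul_smul, ← Matrix.mul_assoc, hU s, Matrix.smul_mul,
    smul_smul, Matrix.mul_assoc, mul_comm]

theorem Intertwines.smul {z : ℂ} {U : Matrix m m ℂ} (hU : Intertwines A z U) (c : ℂ) :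
    Intertwines A z (c • U) := fun s => by
  rw [Matrix.smul_mul, hU s, Matrix.mul_smul, smul_comm]

/-- The adjoint relation: `(A s) U† = z̄ U† (A s)`. -/
theorem Intertwines.adjoint {z : ℂ} {U : Matrix m m ℂ} (hU : Intertwines A z U) (s : ι) :
    A s * Uᴴ = star z • (Uᴴ * A s) := by
  have := congrArg Matrix.conjTranspose (hU s)
  simpa [conjTranspose_smul] using this

variable [DecidableEq m]

theorem Intertwines.one : Intertwines A 1 (1 : Matrix m m ℂ) := fun s => by simp

theorem Intertwines.pow {z : ℂ} {U : Matrix m m ℂ} (hU : Intertwines A z U) (n : ℕ) :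
    Intertwines A (z ^ n) (U ^ n) := by
  induction n with
  | zero => simpa using Intertwines.one
  | succ n ih => simpa [pow_succ] using ih.mul hU

theorem Intertwines.conjTranspose {z : ℂ} (hz : z ≠ 0) {U : Matrix m m ℂ} (hU1 : Uᴴ * U = 1)
    (hU : Intertwines A z U) : Intertwines A z⁻¹ Uᴴ := fun s => by
  have hU2 : U * Uᴴ = 1 := mul_eq_one_comm.1 hU1
  have h1 : (A s)ᴴ * Uᴴ = z • (Uᴴ * (A s)ᴴ) := by
    calc (A s)ᴴ * Uᴴ = Uᴴ * (U * (A s)ᴴ) * Uᴴ := by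
          rw [← Matrix.mul_assoc, hU1, Matrix.one_mul]
      _ = z • (Uᴴ * (A s)ᴴ) := by
          rw [hU s, Matrix.mul_smul, Matrix.smul_mul, Matrix.mul_assoc, Matrix.mul_assoc, hU2,
            Matrix.mul_one]
  rw [h1, smul_smul, inv_mul_cancel₀ hz, one_smul]

end Intertwines

section Kraus

variable {ι m : Type*} [Fintype ι] [Fintype m]

/-- The completely positive map `B ↦ ∑ s, A s B (A s)†` with Kraus operators `A s`. -/
def krausMap (A : ι → Matrix m m ℂ) : Module.End ℂ (Matrix m m ℂ) where
  toFun B := ∑ s, A s * B * (A s)ᴴ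
  map_add' B C := by simp [Matrix.mul_add, Matrix.add_mul, Finset.sum_add_distrib]
  map_smul' c B := by simp [Finset.smul_sum]

theorem krausMap_apply (A : ι → Matrix m m ℂ) (B : Matrix m m ℂ) :
    krausMap A B = ∑ s, A s * B * (A s)ᴴ := rfl

theorem krausMap_conjTranspose (A : ι → Matrix m m ℂ) (B : Matrix m m ℂ) :
    krausMap A Bᴴ = (krausMap A B)ᴴ := by
  simp [krausMap_apply, conjTranspose_sum, conjTranspose_mul, Matrix.mul_assoc]

theorem krausMap_pow_conjTranspose (A : ι → Matrix m m ℂ) (n : ℕ) (B : Matrix m m ℂ) :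
    (krausMap A ^ n) Bᴴ = ((krausMap A ^ n) B)ᴴ := by
  induction n with
  | zero => simp
  | succ n ih =>
    rw [pow_succ', Module.End.mul_apply, Module.End.mul_apply, ih, krausMap_conjTranspose]

theorem trace_mul_krausMap (A : ι → Matrix m m ℂ) (σ B : Matrix m m ℂ) :
    (σ * krausMap A B).trace = ((∑ s, (A s)ᴴ * σ * A s) * B).trace := by
  rw [krausMap_apply, Matrix.mul_sum, Matrix.sum_mul, trace_sum, trace_sum]
  refine Finset.sum_congr rfl fun s _ => ?_
  rw [← Matrix.mul_assoc, trace_mul_comm]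
  simp only [Matrix.mul_assoc]

theorem eq_zero_of_trace_mul_mul_conjTranspose {ρ D : Matrix m m ℂ} (hρ : ρ.PosDef)
    (h : (D * ρ * Dᴴ).trace = 0) : D = 0 := by
  classical
  have h0 := (hρ.posSemidef.mul_mul_conjTranspose_same D).trace_eq_zero_iff.1 h
  have h1 : ∀ x, Dᴴ *ᵥ x = 0 := by
    intro x
    by_contra hx
    have h2 := hρ.dotProduct_mulVec_pos hx
    have h3 : star (Dᴴ *ᵥ x) ⬝ᵥ (ρ *ᵥ (Dᴴ *ᵥ x)) = star x ⬝ᵥ ((D * ρ * Dᴴ) *ᵥ x) := by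
      rw [star_mulVec, conjTranspose_conjTranspose, ← dotProduct_mulVec, mulVec_mulVec,
        mulVec_mulVec, Matrix.mul_assoc]
    rw [h3, h0] at h2
    simp at h2
  have h2 : Dᴴ = 0 := by
    ext i j
    simpa using congrFun (h1 (Pi.single j 1)) i
  simpa using congrArg conjTranspose h2

variable [DecidableEq m]

/-- The Kraus operators `A s` define a unital map, and the faithful density matrix `ρ` is its
unique invariant density matrix. -/
structure IsErgodicKraus (A : ι → Matrix m m ℂ) (ρ : Matrix m m ℂ) : Prop where
  unital : ∑ s, A s * (A s)ᴴ = 1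
  posDef : ρ.PosDef
  trace_eq_one : ρ.trace = 1
  invariant : ∑ s, (A s)ᴴ * ρ * A s = ρ
  unique : ∀ σ : Matrix m m ℂ, IsDensityMatrix σ → ∑ s, (A s)ᴴ * σ * A s = σ → σ = ρ

/-- The defect in the Schwarz inequality for `krausMap A` as a sum of squares. -/
theorem krausMap_schwarz_defect {A : ι → Matrix m m ℂ} (h : ∑ s, A s * (A s)ᴴ = 1)
    (X : Matrix m m ℂ) :
    ∑ s, (X * (A s)ᴴ - (A s)ᴴ * krausMap A X)ᴴ * (X * (A s)ᴴ - (A s)ᴴ * krausMap A X) =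
      krausMap A (Xᴴ * X) - (krausMap A X)ᴴ * krausMap A X := by
  set Y := krausMap A X with hY
  have h1 : ∀ s, (X * (A s)ᴴ - (A s)ᴴ * Y)ᴴ * (X * (A s)ᴴ - (A s)ᴴ * Y) =
      A s * (Xᴴ * X) * (A s)ᴴ - (A s * Xᴴ * (A s)ᴴ) * Y - Yᴴ * (A s * X * (A s)ᴴ) +
        Yᴴ * (A s * (A s)ᴴ) * Y := by
    intro s
    simp only [conjTranspose_sub, conjTranspose_mul, conjTranspose_conjTranspose]
    noncomm_ring
  simp only [h1, Finset.sum_add_distrib, Finset.sum_sub_distrib, ← Matrix.sum_mul,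
    ← Matrix.mul_sum, h]
  rw [← krausMap_apply, ← krausMap_apply, ← krausMap_apply, krausMap_conjTranspose, ← hY,
    Matrix.mul_one]
  abel

variable {A : ι → Matrix m m ℂ}

theorem Intertwines.krausMap_eq (h : ∑ s, A s * (A s)ᴴ = 1) {z : ℂ} {U : Matrix m m ℂ}
    (hU : Intertwines A z U) : krausMap A U = z • U := by
  rw [krausMap_apply]
  calc ∑ s, A s * U * (A s)ᴴ = ∑ s, z • ((A s * (A s)ᴴ) * U) :=
        Finset.sum_congr rfl fun s _ => by
          rw [Matrix.mul_assoc, hU s, Matrix.mul_smul, Matrix.mul_assoc]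
    _ = z • U := by rw [← Finset.smul_sum, ← Matrix.sum_mul, h, Matrix.one_mul]

namespace IsErgodicKraus

variable {ρ : Matrix m m ℂ} (hA : IsErgodicKraus A ρ)
include hA

theorem trace_mul_krausMap_eq (B : Matrix m m ℂ) : (ρ * krausMap A B).trace = (ρ * B).trace := by
  rw [trace_mul_krausMap, hA.invariant]

theorem trace_mul_krausMap_pow_eq (n : ℕ) (B : Matrix m m ℂ) :
    (ρ * (krausMap A ^ n) B).trace = (ρ * B).trace := by
  induction n with
  | zero => simp
  | succ n ih => rw [pow_succ', Module.End.mul_apply, hA.trace_mul_krausMap_eq, ih]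

theorem krausMap_pow_one (n : ℕ) : (krausMap A ^ n) 1 = 1 := by
  induction n with
  | zero => simp
  | succ n ih =>
    rw [pow_succ', Module.End.mul_apply, ih, krausMap_apply]
    simpa using hA.unital

theorem nonempty : Nonempty m :=
  IsDensityMatrix.nonempty ⟨hA.posDef.posSemidef, hA.trace_eq_one⟩

theorem trace_mul_conjTranspose_mul_nonneg (D : Matrix m m ℂ) : 0 ≤ (ρ * (Dᴴ * D)).trace := by
  rw [← Matrix.mul_assoc, trace_mul_comm, ← Matrix.mul_assoc]
  exact (hA.posDef.posSemidef.mul_mul_conjTranspose_same D).trace_nonneg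

theorem eq_zero_of_trace_mul_eq_zero {D : Matrix m m ℂ} (h : (ρ * (Dᴴ * D)).trace = 0) :
    D = 0 := by
  rw [← Matrix.mul_assoc, trace_mul_comm, ← Matrix.mul_assoc] at h
  exact eq_zero_of_trace_mul_mul_conjTranspose hA.posDef h

/-- The expectation of the Schwarz defect of an eigenvector in the invariant state. -/
theorem trace_schwarz_defect {z : ℂ} {X : Matrix m m ℂ} (hX : krausMap A X = z • X) :
    ∑ s, (ρ * ((X * (A s)ᴴ - z • ((A s)ᴴ * X))ᴴ * (X * (A s)ᴴ - z • ((A s)ᴴ * X)))).trace =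
      (1 - star z * z) * (ρ * (Xᴴ * X)).trace := by
  have h := krausMap_schwarz_defect hA.unital X
  rw [hX] at h
  simp only [Matrix.mul_smul] at h
  rw [← trace_sum, ← Matrix.mul_sum, h, Matrix.mul_sub, trace_sub, hA.trace_mul_krausMap_eq,
    conjTranspose_smul, Matrix.smul_mul, smul_smul, Matrix.mul_smul, trace_smul,
    smul_eq_mul, sub_mul, one_mul, mul_comm z]

theorem norm_eigenvalue_le_one {z : ℂ} {X : Matrix m m ℂ} (hX : krausMap A X = z • X)
    (hX0 : X ≠ 0) : ‖z‖ ≤ 1 := by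
  have h := hA.trace_schwarz_defect hX
  have h1 : 0 ≤ (1 - star z * z) * (ρ * (Xᴴ * X)).trace := by
    rw [← h]
    exact Finset.sum_nonneg fun s _ => hA.trace_mul_conjTranspose_mul_nonneg _
  have h2 : 0 < (ρ * (Xᴴ * X)).trace :=
    lt_of_le_of_ne (hA.trace_mul_conjTranspose_mul_nonneg X)
      fun h0 => hX0 (hA.eq_zero_of_trace_mul_eq_zero h0.symm)
  have h3 : (1 - star z * z) = ((1 - ‖z‖ ^ 2 : ℝ) : ℂ) := by
    rw [star_mul_self_eq_norm_sq]; push_cast; rfl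
  rw [h3] at h1
  have h4 := (Complex.nonneg_iff.1 h1).1
  rw [Complex.re_ofReal_mul] at h4
  have h5 : 0 ≤ 1 - ‖z‖ ^ 2 := nonneg_of_mul_nonneg_left h4 (Complex.pos_iff.1 h2).1
  nlinarith [norm_nonneg z]

/-- An eigenvector of modulus one saturates the Schwarz inequality in the faithful invariant
state, so it intertwines the Kraus operators. -/
theorem intertwines_of_eigenvector {z : ℂ} {X : Matrix m m ℂ} (hX : krausMap A X = z • X)
    (hz : star z * z = 1) : Intertwines A z X := by
  have h := hA.trace_schwarz_defect hX
  rw [hz, sub_self, zero_mul, Finset.sum_eq_zero_iff_of_nonneg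
    fun s _ => hA.trace_mul_conjTranspose_mul_nonneg _] at h
  exact fun s => sub_eq_zero.1 (hA.eq_zero_of_trace_mul_eq_zero (h s (Finset.mem_univ s)))

theorem eq_smul_of_posSemidef_invariant {N : Matrix m m ℂ} (hN : N.PosSemidef)
    (h : ∑ s, (A s)ᴴ * N * A s = N) : ∃ t : ℝ, N = t • ρ := by
  have := hA.nonempty
  obtain ⟨t, D, -, hD, hND⟩ := exists_eq_smul_isDensityMatrix hN
  refine ⟨t, ?_⟩
  by_cases h0 : t = 0
  · rw [hND, h0, zero_smul, zero_smul]
  · rw [hND, hA.unique D hD ?_]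
    rw [hND] at h
    simp only [Matrix.mul_smul, Matrix.smul_mul, ← Finset.smul_sum] at h
    exact smul_right_injective _ h0 h

/-- Conjugation by an intertwiner maps the invariant state to an invariant matrix. -/
theorem invariant_conj {z : ℂ} (hz : star z * z = 1) {X : Matrix m m ℂ} (hX : Intertwines A z X) :
    ∑ s, (A s)ᴴ * (X * ρ * Xᴴ) * A s = X * ρ * Xᴴ := by
  have hz0 : z ≠ 0 := by rintro rfl; simp at hz
  have h1 : ∀ s, (A s)ᴴ * (X * ρ * Xᴴ) * A s = X * ((A s)ᴴ * ρ * A s) * Xᴴ := by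
    intro s
    have e1 : (A s)ᴴ * X = z⁻¹ • (X * (A s)ᴴ) := by
      rw [hX s, smul_smul, inv_mul_cancel₀ hz0, one_smul]
    have e2 : Xᴴ * A s = z • (A s * Xᴴ) := by
      rw [hX.adjoint s, smul_smul, mul_comm, hz, one_smul]
    calc (A s)ᴴ * (X * ρ * Xᴴ) * A s = ((A s)ᴴ * X) * ρ * (Xᴴ * A s) := by
          simp only [Matrix.mul_assoc]
      _ = X * ((A s)ᴴ * ρ * A s) * Xᴴ := by
          rw [e1, e2, Matrix.smul_mul, Matrix.smul_mul, Matrix.mul_smul, smul_smul,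
            inv_mul_cancel₀ hz0, one_smul]
          simp only [Matrix.mul_assoc]
  simp only [h1, ← Matrix.sum_mul, ← Matrix.mul_sum, hA.invariant]

/-- A fixed point `Z` is a scalar: subtract from `Z` a number `w` for which `Z - w` is singular;
then `(Z - w) ρ (Z - w)†` is invariant, hence a multiple of the nonsingular `ρ`, hence zero. -/
theorem eq_smul_one_of_fixed {Z : Matrix m m ℂ} (hZ : krausMap A Z = Z) : ∃ c : ℂ, Z = c • 1 := by
  have := hA.nonempty
  obtain ⟨w, hw⟩ := Module.End.exists_eigenvalue (Matrix.toLin' Zᴴ)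
  obtain ⟨v, hv⟩ := hw.exists_hasEigenvector
  have hv1 : Zᴴ *ᵥ v = w • v := by simpa using hv.apply_eq_smul
  refine ⟨star w, ?_⟩
  set Y := Z - star w • (1 : Matrix m m ℂ) with hY
  have hYv : Yᴴ *ᵥ v = 0 := by
    rw [hY, conjTranspose_sub, conjTranspose_smul, star_star, conjTranspose_one, sub_mulVec,
      smul_mulVec, one_mulVec, hv1, sub_self]
  have hYI : Intertwines A 1 Y := by
    refine hA.intertwines_of_eigenvector ?_ (by simp)
    rw [hY, map_sub, map_smul, hZ, one_smul, krausMap_apply]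
    simp [hA.unital]
  obtain ⟨t, ht⟩ := hA.eq_smul_of_posSemidef_invariant
    (hA.posDef.posSemidef.mul_mul_conjTranspose_same Y) (hA.invariant_conj (by simp) hYI)
  have h1 : star v ⬝ᵥ ((t • ρ) *ᵥ v) = 0 := by
    rw [← ht, ← mulVec_mulVec, hYv, mulVec_zero, dotProduct_zero]
  have h2 := hA.posDef.dotProduct_mulVec_pos hv.2
  have h3 : t = 0 := by
    rw [smul_mulVec, dotProduct_smul, smul_eq_zero] at h1
    exact h1.resolve_right h2.ne'
  rw [h3, zero_smul] at ht
  exact sub_eq_zero.1 (eq_zero_of_trace_mul_mul_conjTranspose hA.posDef (by rw [ht, trace_zero]))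

theorem krausMap_conjTranspose_mul {z : ℂ} (hz : star z * z = 1) {X Y : Matrix m m ℂ}
    (hX : Intertwines A z X) (hY : Intertwines A z Y) : krausMap A (Xᴴ * Y) = Xᴴ * Y := by
  have h1 : ∀ s, A s * (Xᴴ * Y) * (A s)ᴴ = Xᴴ * (A s * (A s)ᴴ) * Y := by
    intro s
    calc A s * (Xᴴ * Y) * (A s)ᴴ = (A s * Xᴴ) * (Y * (A s)ᴴ) := by simp only [Matrix.mul_assoc]
      _ = Xᴴ * (A s * (A s)ᴴ) * Y := by
        rw [hX.adjoint s, hY s, Matrix.mul_smul, Matrix.smul_mul, smul_smul, mul_comm, hz,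
          one_smul]
        simp only [Matrix.mul_assoc]
  rw [krausMap_apply]
  simp only [h1, ← Matrix.sum_mul, ← Matrix.mul_sum, hA.unital, Matrix.mul_one]

/-- For an intertwiner `X` the matrix `X† X` is a fixed point, so `X` is a multiple of a unitary. -/
theorem exists_smul_unitary {z : ℂ} (hz : star z * z = 1) {X : Matrix m m ℂ}
    (hX : Intertwines A z X) (hX0 : X ≠ 0) : ∃ c : ℂ, c ≠ 0 ∧ (c • X)ᴴ * (c • X) = 1 := by
  have := hA.nonempty
  obtain ⟨c, hc⟩ := hA.eq_smul_one_of_fixed (hA.krausMap_conjTranspose_mul hz hX hX)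
  have hc0 : 0 ≤ c := by
    have h := (posSemidef_conjTranspose_mul_self X).diag_nonneg (i := Classical.arbitrary m)
    rw [hc] at h
    simpa using h
  obtain ⟨t, rfl⟩ : ∃ t : ℝ, c = t := ⟨c.re, Complex.ext rfl (by
    simp [← (Complex.nonneg_iff.1 hc0).2])⟩
  have ht : 0 ≤ t := by exact_mod_cast hc0
  have ht0 : 0 < t := by
    refine lt_of_le_of_ne ht fun h0 => hX0 ?_
    rw [← h0, Complex.ofReal_zero, zero_smul] at hc
    exact conjTranspose_mul_self_eq_zero.1 hc
  have hs : (Real.sqrt t)⁻¹ * (Real.sqrt t)⁻¹ * t = 1 := by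
    rw [← mul_inv, Real.mul_self_sqrt ht, inv_mul_cancel₀ ht0.ne']
  refine ⟨((Real.sqrt t)⁻¹ : ℝ), ?_, ?_⟩
  · have : 0 < Real.sqrt t := Real.sqrt_pos.2 ht0
    exact_mod_cast (inv_pos.2 this).ne'
  · rw [conjTranspose_smul, Matrix.smul_mul, Matrix.mul_smul, hc, smul_smul, smul_smul]
    have : star (((Real.sqrt t)⁻¹ : ℝ) : ℂ) = (((Real.sqrt t)⁻¹ : ℝ) : ℂ) := Complex.conj_ofReal _
    rw [this, ← Complex.ofReal_mul, ← Complex.ofReal_mul, hs, Complex.ofReal_one, one_smul]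

end IsErgodicKraus

end Kraus

/-! ### The peripheral spectrum -/

section Peripheral

variable {ι m : Type*} [Fintype ι] [Fintype m] [DecidableEq m]

/-- The peripheral eigenvalues of `krausMap A`, in the form of the group of all `z` of modulus one
for which the Kraus operators have a unitary `z`-intertwiner. -/
def peripheralGroup (A : ι → Matrix m m ℂ) : Subgroup ℂˣ where
  carrier := {z | ‖(z : ℂ)‖ = 1 ∧ ∃ U : Matrix m m ℂ, Uᴴ * U = 1 ∧ Intertwines A z U}
  mul_mem' := by
    rintro z w ⟨hz, U, hU, hUA⟩ ⟨hw, W, hW, hWA⟩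
    refine ⟨by simp [hz, hw], U * W, ?_, by simpa using hUA.mul hWA⟩
    rw [conjTranspose_mul, Matrix.mul_assoc, ← Matrix.mul_assoc Uᴴ, hU, Matrix.one_mul, hW]
  one_mem' := ⟨by simp, 1, by simp, by simpa using Intertwines.one⟩
  inv_mem' := by
    rintro z ⟨hz, U, hU, hUA⟩
    refine ⟨by simp [hz], Uᴴ, ?_, by simpa using hUA.conjTranspose z.ne_zero hU⟩
    rw [conjTranspose_conjTranspose, mul_eq_one_comm.1 hU]

theorem conjTranspose_pow_mul_pow {U : Matrix m m ℂ} (hU : Uᴴ * U = 1) (n : ℕ) :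
    (U ^ n)ᴴ * U ^ n = 1 := by
  rw [conjTranspose_pow, ← (show Commute Uᴴ U from hU.trans (mul_eq_one_comm.1 hU).symm).mul_pow,
    hU, one_pow]

theorem conj_krausMap {A : ι → Matrix m m ℂ} {z : ℂ} {U : Matrix m m ℂ} (hz : ‖z‖ = 1)
    (hU : Uᴴ * U = 1) (hUA : Intertwines A z U) (B : Matrix m m ℂ) :
    U * krausMap A B * Uᴴ = krausMap A (U * B * Uᴴ) := by
  rw [krausMap_apply, krausMap_apply, Matrix.mul_sum, Matrix.sum_mul]
  refine Finset.sum_congr rfl fun s _ => ?_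
  have hz1 := star_mul_self_of_norm hz
  have hz0 : z ≠ 0 := by rintro rfl; simp at hz
  have e1 : U * A s = z⁻¹ • (A s * U) := by
    have h2 := (hUA.conjTranspose hz0 hU).adjoint s
    rw [conjTranspose_conjTranspose] at h2
    rw [h2, smul_smul]
    have : z⁻¹ * star z⁻¹ = 1 := by rw [star_inv₀, ← mul_inv, mul_comm, hz1, inv_one]
    rw [this, one_smul]
  have e2 : (A s)ᴴ * Uᴴ = z • (Uᴴ * (A s)ᴴ) := by
    rw [hUA.conjTranspose hz0 hU s, smul_smul, mul_inv_cancel₀ hz0, one_smul]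
  calc U * (A s * B * (A s)ᴴ) * Uᴴ = (U * A s) * B * ((A s)ᴴ * Uᴴ) := by
        simp only [Matrix.mul_assoc]
    _ = A s * (U * B * Uᴴ) * (A s)ᴴ := by
        rw [e1, e2, Matrix.smul_mul, Matrix.smul_mul, Matrix.mul_smul, smul_smul,
          inv_mul_cancel₀ hz0, one_smul]
        simp only [Matrix.mul_assoc]

theorem conj_krausMap_pow {A : ι → Matrix m m ℂ} {z : ℂ} {U : Matrix m m ℂ} (hz : ‖z‖ = 1)
    (hU : Uᴴ * U = 1) (hUA : Intertwines A z U) (n : ℕ) (B : Matrix m m ℂ) :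
    U * (krausMap A ^ n) B * Uᴴ = (krausMap A ^ n) (U * B * Uᴴ) := by
  induction n with
  | zero => simp
  | succ n ih =>
    rw [pow_succ', Module.End.mul_apply, Module.End.mul_apply, conj_krausMap hz hU hUA, ih]

namespace IsErgodicKraus

variable {A : ι → Matrix m m ℂ} {ρ : Matrix m m ℂ} (hA : IsErgodicKraus A ρ)
include hA

theorem finite_peripheralGroup : Finite (peripheralGroup A) := by
  have := hA.nonempty
  have hfin : Set.Finite {z : ℂ | (krausMap A).HasEigenvalue z} :=
    Module.End.finite_hasEigenvalue _
  refine Set.Finite.to_subtype ((hfin.preimage (f := ((↑) : ℂˣ → ℂ))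
    (Units.val_injective.injOn)).subset ?_)
  rintro z ⟨-, U, hU, hUA⟩
  refine Module.End.hasEigenvalue_of_hasEigenvector (x := U)
    ⟨Module.End.mem_eigenspace_iff.2 (hUA.krausMap_eq hA.unital), ?_⟩
  rintro rfl
  simp at hU

/-- Unitary eigenvectors for one and the same peripheral eigenvalue are proportional. -/
theorem eq_smul_of_intertwines {z : ℂ} (hz : ‖z‖ = 1) {U X : Matrix m m ℂ} (hU : Uᴴ * U = 1)
    (hUA : Intertwines A z U) (hXA : Intertwines A z X) : ∃ c : ℂ, X = c • U := by
  obtain ⟨c, hc⟩ := hA.eq_smul_one_of_fixed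
    (hA.krausMap_conjTranspose_mul (star_mul_self_of_norm hz) hUA hXA)
  refine ⟨c, ?_⟩
  calc X = U * (Uᴴ * X) := by rw [← Matrix.mul_assoc, mul_eq_one_comm.1 hU, Matrix.one_mul]
    _ = c • U := by rw [hc, Matrix.mul_smul, Matrix.mul_one]

/-- The peripheral eigenvalues form a finite, hence cyclic, group. The eigenvector `U` of a
generator therefore commutes with all peripheral eigenvectors. -/
theorem exists_generator : ∃ (z : ℂ) (U : Matrix m m ℂ), ‖z‖ = 1 ∧ Uᴴ * U = 1 ∧
    Intertwines A z U ∧ ∀ (w : ℂ) (X : Matrix m m ℂ), ‖w‖ = 1 → X ≠ 0 → Intertwines A w X →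
      Commute U X ∧ (z = 1 → w = 1) := by
  have := hA.finite_peripheralGroup
  obtain ⟨⟨z, hz, U, hU, hUA⟩, hgen⟩ := IsCyclic.exists_generator (α := peripheralGroup A)
  refine ⟨z, U, hz, hU, hUA, fun w X hw hX hXA => ?_⟩
  obtain ⟨c, hc, hcX⟩ := hA.exists_smul_unitary (star_mul_self_of_norm hw) hXA hX
  have hw0 : w ≠ 0 := by rintro rfl; simp at hw
  have hmem : Units.mk0 w hw0 ∈ peripheralGroup A := ⟨hw, c • X, hcX, hXA.smul c⟩
  obtain ⟨n, hn⟩ := ((isOfFinOrder_of_finite _).mem_powers_iff_mem_zpowers).2 (hgen ⟨_, hmem⟩)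
  have hn' : (z : ℂ) ^ n = w := by
    have := congrArg (fun y : peripheralGroup A => ((y : ℂˣ) : ℂ)) hn
    simpa using this
  refine ⟨?_, fun h1 => by rw [← hn', h1, one_pow]⟩
  obtain ⟨a, rfl⟩ := hA.eq_smul_of_intertwines hw (conjTranspose_pow_mul_pow hU n)
    (hn' ▸ hUA.pow n) hXA
  exact (Commute.pow_right (Commute.refl U) n).smul_right a

/-- The powers of `krausMap A` tend to zero on the range of `B ↦ B - U B U†`: this invariant
subspace contains no peripheral eigenvector, as all of them commute with `U`. -/
theorem tendsto_krausMap_pow_sub_conj {z : ℂ} {U : Matrix m m ℂ} (hz : ‖z‖ = 1) (hU : Uᴴ * U = 1)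
    (hUA : Intertwines A z U)
    (hcomm : ∀ (w : ℂ) (X : Matrix m m ℂ), ‖w‖ = 1 → X ≠ 0 → Intertwines A w X → Commute U X)
    (B : Matrix m m ℂ) (f : Matrix m m ℂ →ₗ[ℂ] ℂ) :
    Filter.Tendsto (fun n => f ((krausMap A ^ n) (B - U * B * Uᴴ))) Filter.atTop (nhds 0) := by
  let T : Module.End ℂ (Matrix m m ℂ) :=
    LinearMap.id - LinearMap.mulRight ℂ Uᴴ ∘ₗ LinearMap.mulLeft ℂ U
  have hT : ∀ B, T B = B - U * B * Uᴴ := fun B => rfl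
  have hUz := conj_krausMap hz hU hUA
  have hTΦ : ∀ B, krausMap A (T B) = T (krausMap A B) := by
    intro B
    rw [hT, hT, map_sub, hUz]
  have hmaps : ∀ X ∈ LinearMap.range T, krausMap A X ∈ LinearMap.range T := by
    rintro _ ⟨B, rfl⟩
    exact ⟨krausMap A B, (hTΦ B).symm⟩
  obtain ⟨r, hr0, hr1, hdecay⟩ := exists_pow_decay ((krausMap A).restrict hmaps) (by
    intro w hw
    obtain ⟨⟨X, hXr⟩, hX⟩ := hw.exists_hasEigenvector
    have hXe : krausMap A X = w • X := congrArg Subtype.val hX.apply_eq_smul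
    have hX0 : X ≠ 0 := fun h => hX.2 (Subtype.ext h)
    refine lt_of_le_of_ne (hA.norm_eigenvalue_le_one hXe hX0) fun hw1 => hX0 ?_
    have hc := hcomm w X hw1 hX0
      (hA.intertwines_of_eigenvector hXe (star_mul_self_of_norm hw1))
    -- `X = B - U B U†` commutes with `U`, so it is orthogonal to itself
    obtain ⟨B, hB⟩ := hXr
    have h1 : (Xᴴ * X).trace = 0 := by
      have h2 : Uᴴ * Xᴴ * U = Xᴴ := by
        rw [← conjTranspose_mul, ← hc.eq, conjTranspose_mul, Matrix.mul_assoc, hU, Matrix.mul_one]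
      have h3 : (Xᴴ * (U * B * Uᴴ)).trace = (Xᴴ * B).trace := by
        rw [← Matrix.mul_assoc, trace_mul_comm]
        conv_rhs => rw [← h2]
        simp only [Matrix.mul_assoc]
      calc (Xᴴ * X).trace = (Xᴴ * (B - U * B * Uᴴ)).trace := by rw [← hT, hB]
        _ = 0 := by rw [Matrix.mul_sub, trace_sub, h3, sub_self]
    exact trace_conjTranspose_mul_self_eq_zero_iff.1 h1)
  obtain ⟨C, hC⟩ := hdecay ⟨T B, B, rfl⟩ (f ∘ₗ (LinearMap.range T).subtype)
  refine squeeze_zero_norm (fun n => ?_) (by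
    simpa using (tendsto_pow_atTop_nhds_zero_of_lt_one hr0.le hr1).const_mul C)
  have h := hC n
  rw [Module.End.pow_restrict] at h
  exact h

/-- If `1` is the only peripheral eigenvalue, the powers of `krausMap A` converge exponentially fast
to the projection `B ↦ Tr(ρ B) 1`. -/
theorem exists_exponential_convergence
    (hper : ∀ (w : ℂ) (X : Matrix m m ℂ), ‖w‖ = 1 → X ≠ 0 → Intertwines A w X → w = 1) :
    ∃ r : ℝ, 0 < r ∧ r < 1 ∧ ∀ (B : Matrix m m ℂ) (i j : m), ∃ C : ℝ, ∀ n : ℕ,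
      ‖(krausMap A ^ n) B i j - (ρ * B).trace * (1 : Matrix m m ℂ) i j‖ ≤ C * r ^ n := by
  let t : Matrix m m ℂ →ₗ[ℂ] ℂ := traceLinearMap m ℂ ℂ ∘ₗ LinearMap.mulLeft ℂ ρ
  have ht : ∀ B, t B = (ρ * B).trace := fun B => rfl
  have hmaps : ∀ X ∈ LinearMap.ker t, krausMap A X ∈ LinearMap.ker t := by
    intro X hX
    rw [LinearMap.mem_ker, ht] at hX ⊢
    rw [hA.trace_mul_krausMap_eq, hX]
  obtain ⟨r, hr0, hr1, hdecay⟩ := exists_pow_decay ((krausMap A).restrict hmaps) (by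
    intro w hw
    obtain ⟨⟨X, hXr⟩, hX⟩ := hw.exists_hasEigenvector
    have hXe : krausMap A X = w • X := congrArg Subtype.val hX.apply_eq_smul
    have hX0 : X ≠ 0 := fun h => hX.2 (Subtype.ext h)
    refine lt_of_le_of_ne (hA.norm_eigenvalue_le_one hXe hX0) fun hw1 => hX0 ?_
    obtain rfl := hper w X hw1 hX0
      (hA.intertwines_of_eigenvector hXe (star_mul_self_of_norm hw1))
    obtain ⟨c, hc⟩ := hA.eq_smul_one_of_fixed (hXe.trans (one_smul _ X))
    rw [LinearMap.mem_ker, ht, hc, Matrix.mul_smul, Matrix.mul_one, trace_smul, hA.trace_eq_one,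
      smul_eq_mul, mul_one] at hXr
    rw [hc, hXr, zero_smul])
  refine ⟨r, hr0, hr1, fun B i j => ?_⟩
  have hB : B - (ρ * B).trace • (1 : Matrix m m ℂ) ∈ LinearMap.ker t := by
    rw [LinearMap.mem_ker, ht, Matrix.mul_sub, trace_sub, Matrix.mul_smul, Matrix.mul_one,
      trace_smul, hA.trace_eq_one, smul_eq_mul, mul_one, sub_self]
  obtain ⟨C, hC⟩ := hdecay ⟨_, hB⟩ (Matrix.entryLinearMap ℂ ℂ i j ∘ₗ (LinearMap.ker t).subtype)
  refine ⟨C, fun n => ?_⟩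
  have h := hC n
  rw [Module.End.pow_restrict] at h
  have e : (krausMap A ^ n) (B - (ρ * B).trace • (1 : Matrix m m ℂ)) =
      (krausMap A ^ n) B - (ρ * B).trace • (1 : Matrix m m ℂ) := by
    rw [map_sub, map_smul, hA.krausMap_pow_one]
  have h' : ‖(krausMap A ^ n) (B - (ρ * B).trace • (1 : Matrix m m ℂ)) i j‖ ≤ C * r ^ n := h
  rw [e] at h'
  simpa [Matrix.sub_apply, Matrix.smul_apply] using h'

end IsErgodicKraus

end Peripheral

/-! ### Products of Kraus operators -/

section Words

theorem sum_comm_four {κ κ' M : Type*} [Fintype κ] [Fintype κ'] [AddCommMonoid M]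
    (g : κ → κ → κ' → κ' → M) :
    ∑ k, ∑ q, ∑ x, ∑ y, g k q x y = ∑ x, ∑ y, ∑ k, ∑ q, g k q x y := by
  calc ∑ k, ∑ q, ∑ x, ∑ y, g k q x y = ∑ k, ∑ x, ∑ q, ∑ y, g k q x y :=
        Finset.sum_congr rfl fun k _ => Finset.sum_comm
    _ = ∑ x, ∑ k, ∑ q, ∑ y, g k q x y := Finset.sum_comm
    _ = ∑ x, ∑ k, ∑ y, ∑ q, g k q x y :=
        Finset.sum_congr rfl fun x _ => Finset.sum_congr rfl fun k _ => Finset.sum_comm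
    _ = ∑ x, ∑ y, ∑ k, ∑ q, g k q x y := Finset.sum_congr rfl fun x _ => Finset.sum_comm

variable {ι m : Type*} [Fintype m] [DecidableEq m]

/-- The product `A (x 0) * A (x 1) * ⋯ * A (x (n - 1))`. -/
def word (A : ι → Matrix m m ℂ) {n : ℕ} (x : Fin n → ι) : Matrix m m ℂ :=
  (List.ofFn fun i => A (x i)).prod

theorem word_zero (A : ι → Matrix m m ℂ) (x : Fin 0 → ι) : word A x = 1 := by
  simp [word]

theorem word_cons (A : ι → Matrix m m ℂ) {n : ℕ} (s : ι) (x : Fin n → ι) :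
    word A (Fin.cons s x : Fin (n + 1) → ι) = A s * word A x := by
  simp [word, List.ofFn_succ]

theorem word_snoc (A : ι → Matrix m m ℂ) {n : ℕ} (x : Fin n → ι) (s : ι) :
    word A (Fin.snoc x s : Fin (n + 1) → ι) = word A x * A s := by
  simp only [word, List.ofFn_succ', Fin.snoc_castSucc, Fin.snoc_last]
  simp

variable [Fintype ι]

theorem krausMap_pow_apply (A : ι → Matrix m m ℂ) (n : ℕ) (B : Matrix m m ℂ) :
    (krausMap A ^ n) B = ∑ x : Fin n → ι, word A x * B * (word A x)ᴴ := by
  induction n with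
  | zero => simp [word_zero]
  | succ n ih =>
    rw [pow_succ', Module.End.mul_apply, ih, krausMap_apply,
      ← (Fin.consEquiv fun _ : Fin (n + 1) => ι).sum_comp, Fintype.sum_prod_type]
    refine Finset.sum_congr rfl fun s _ => ?_
    rw [Matrix.mul_sum, Matrix.sum_mul]
    refine Finset.sum_congr rfl fun x _ => ?_
    have : word A ((Fin.consEquiv fun _ : Fin (n + 1) => ι) (s, x)) = A s * word A x :=
      word_cons A s x
    rw [this, conjTranspose_mul]
    simp only [Matrix.mul_assoc]

theorem sum_single_mul_mul_single (Z : Matrix m m ℂ) :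
    ∑ k, ∑ q, single k q (1 : ℂ) * Z * single q k 1 = Z.trace • (1 : Matrix m m ℂ) := by
  ext i j
  simp only [Matrix.sum_apply, single_mul_mul_single, Matrix.smul_apply, one_apply, smul_eq_mul,
    one_mul, mul_one, single_apply, trace, diag_apply]
  by_cases h : i = j
  · subst h
    simp
  · have : ∀ k, ¬ (k = i ∧ k = j) := fun k hk => h (hk.1.symm.trans hk.2)
    simp [h, this]

/-- An exchange identity: the pairing of two families of expectations, summed over all words, in
terms of the powers of `krausMap A` on the matrix units. -/
theorem sum_trace_mul_krausMap_pow_single (A : ι → Matrix m m ℂ) (n : ℕ) (X Y : Matrix m m ℂ) :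
    ∑ k, ∑ q, (Y * (krausMap A ^ n) (single k q 1) * X * (krausMap A ^ n) (single q k 1)).trace =
      ∑ x : Fin n → ι, ∑ y : Fin n → ι,
        (((word A x)ᴴ * X * word A y)).trace * (Y * (word A x * (word A y)ᴴ)).trace := by
  have h1 : ∀ x y : Fin n → ι, word A x * ((((word A x)ᴴ * X * word A y)).trace • 1) *
      (word A y)ᴴ = ∑ k, ∑ q, word A x * single k q 1 * (word A x)ᴴ * X *
        (word A y * single q k 1 * (word A y)ᴴ) := by
    intro x y
    rw [← sum_single_mul_mul_single]
    simp only [Matrix.mul_sum, Matrix.sum_mul, Matrix.mul_assoc]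
  have h2 : ∀ k q : m, (krausMap A ^ n) (single k q 1) * X * (krausMap A ^ n) (single q k 1) =
      ∑ x : Fin n → ι, ∑ y : Fin n → ι, word A x * single k q 1 * (word A x)ᴴ * X *
        (word A y * single q k 1 * (word A y)ᴴ) := fun k q => by
    rw [krausMap_pow_apply, krausMap_pow_apply, Matrix.sum_mul, Finset.sum_mul_sum]
  calc ∑ k, ∑ q, (Y * (krausMap A ^ n) (single k q 1) * X *
        (krausMap A ^ n) (single q k 1)).trace
      = (Y * ∑ k, ∑ q, ((krausMap A ^ n) (single k q 1) * X *
        (krausMap A ^ n) (single q k 1))).trace := by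
        simp only [Matrix.mul_sum, trace_sum, Matrix.mul_assoc]
    _ = (Y * ∑ x : Fin n → ι, ∑ y : Fin n → ι, ∑ k, ∑ q,
          word A x * single k q 1 * (word A x)ᴴ * X *
            (word A y * single q k 1 * (word A y)ᴴ)).trace := by
        simp only [h2]
        rw [sum_comm_four]
    _ = _ := by
        simp only [← h1, Matrix.mul_sum, trace_sum]
        refine Finset.sum_congr rfl fun x _ => Finset.sum_congr rfl fun y _ => ?_
        rw [Matrix.mul_smul, Matrix.mul_one, Matrix.smul_mul, Matrix.mul_smul, trace_smul,
          smul_eq_mul]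

end Words

/-! ### Absence of periodicity from vanishing correlations -/

section Aperiodic

variable {ι m : Type*} [Fintype ι] [Fintype m] [DecidableEq m]

namespace IsErgodicKraus

variable {A : ι → Matrix m m ℂ} {ρ : Matrix m m ℂ} (hA : IsErgodicKraus A ρ)
include hA

/-- The seminorm `B ↦ Tr(ρ B† B)` does not increase under powers of `krausMap A`. -/
theorem trace_krausMap_pow_sq_le (n : ℕ) (B : Matrix m m ℂ) :
    (ρ * (((krausMap A ^ n) B)ᴴ * (krausMap A ^ n) B)).trace ≤ (ρ * (Bᴴ * B)).trace := by
  induction n with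
  | zero => simp
  | succ n ih =>
    refine le_trans ?_ ih
    rw [pow_succ', Module.End.mul_apply]
    set X := (krausMap A ^ n) B
    have h := congrArg (fun M => (ρ * M).trace) (krausMap_schwarz_defect hA.unital X)
    simp only [Matrix.mul_sub ρ, trace_sub, hA.trace_mul_krausMap_eq] at h
    rw [← sub_nonneg, ← h, Matrix.mul_sum, trace_sum]
    exact Finset.sum_nonneg fun s _ => hA.trace_mul_conjTranspose_mul_nonneg _

/-- The Cauchy-Schwarz inequality `|Tr(ρ D)|² ≤ Tr(ρ D† D)`. -/
theorem star_trace_mul_trace_le (D : Matrix m m ℂ) :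
    star (ρ * D).trace * (ρ * D).trace ≤ (ρ * (Dᴴ * D)).trace := by
  set t := (ρ * D).trace with ht
  have h := hA.trace_mul_conjTranspose_mul_nonneg (D - t • 1)
  have ht' : (ρ * Dᴴ).trace = star t := by
    rw [ht, ← trace_conjTranspose, conjTranspose_mul, hA.posDef.1.eq, trace_mul_comm]
  have e : ρ * ((D - t • (1 : Matrix m m ℂ))ᴴ * (D - t • 1)) =
      ρ * (Dᴴ * D) - t • (ρ * Dᴴ) - star t • (ρ * D) + (star t * t) • ρ := by
    simp only [conjTranspose_sub, conjTranspose_smul, conjTranspose_one, Matrix.mul_sub,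
      Matrix.sub_mul, Matrix.mul_smul, Matrix.smul_mul, Matrix.mul_one, Matrix.one_mul, smul_smul,
      smul_sub]
    rw [mul_comm t]
    abel
  rw [e, trace_add, trace_sub, trace_sub, trace_smul, trace_smul, trace_smul, ht', ← ht,
    hA.trace_eq_one] at h
  simp only [smul_eq_mul] at h
  rw [← sub_nonneg]
  convert h using 1
  ring

/-- The orbits of `krausMap A` are bounded, in a form weighted by a root of the invariant state. -/
theorem exists_norm_mul_krausMap_pow_le {C : Matrix m m ℂ} (hC : ρ = Cᴴ * C) (B : Matrix m m ℂ) :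
    ∃ M : ℝ, ∀ (n : ℕ) (i j : m), ‖((krausMap A ^ n) B * Cᴴ) i j‖ ≤ M := by
  refine ⟨Real.sqrt (ρ * (Bᴴ * B)).trace.re, fun n i j => Real.le_sqrt_of_sq_le ?_⟩
  have h := (Complex.le_def.1 (hA.trace_krausMap_pow_sq_le n B)).1
  refine le_trans ?_ h
  set X := (krausMap A ^ n) B
  have e : (ρ * (Xᴴ * X)).trace = ((X * Cᴴ)ᴴ * (X * Cᴴ)).trace := by
    rw [hC, conjTranspose_mul, conjTranspose_conjTranspose, Matrix.mul_assoc, trace_mul_comm]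
    simp only [Matrix.mul_assoc]
  rw [e, trace, Complex.re_sum]
  have h1 : ∀ k, (((X * Cᴴ)ᴴ * (X * Cᴴ)).diag k).re = ∑ l, ‖(X * Cᴴ) l k‖ ^ 2 := by
    intro k
    rw [diag_apply, mul_apply, Complex.re_sum]
    refine Finset.sum_congr rfl fun l _ => ?_
    rw [conjTranspose_apply, star_mul_self_eq_norm_sq, Complex.ofReal_re]
  simp only [h1]
  exact (Finset.single_le_sum (f := fun l => ‖(X * Cᴴ) l j‖ ^ 2) (fun _ _ => sq_nonneg _)
    (Finset.mem_univ i)).trans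
    (Finset.single_le_sum (f := fun k => ∑ l, ‖(X * Cᴴ) l k‖ ^ 2)
      (fun _ _ => Finset.sum_nonneg fun _ _ => sq_nonneg _) (Finset.mem_univ j))

/-- Let `U` be a unitary peripheral eigenvector commuting with all others. The functional
`ρ U` cannot vanish on all products of Kraus operators. Otherwise the exchange identity shows that
`∑ k q, Tr(ρ Φⁿ(U e_kq U†) Φⁿ(e_qk)) = 0` for all `n`, where `Φ = krausMap A`. Since
`Φⁿ(e_kq - U e_kq U†)` tends to zero, so does `∑ k q, Tr(ρ Φⁿ(e_kq) Φⁿ(e_kq)†)`, although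
this is at least `(ρ k k) ^ 2` by the Cauchy-Schwarz inequality. -/
theorem false_of_trace_word_eq_zero {z : ℂ} {U : Matrix m m ℂ} (hz : ‖z‖ = 1) (hU : Uᴴ * U = 1)
    (hUA : Intertwines A z U)
    (hcomm : ∀ (w : ℂ) (X : Matrix m m ℂ), ‖w‖ = 1 → X ≠ 0 → Intertwines A w X → Commute U X)
    (hvan : ∀ (n : ℕ) (x y : Fin n → ι), (ρ * U * (word A x * (word A y)ᴴ)).trace = 0) :
    False := by
  have := hA.nonempty
  obtain ⟨C, hC⟩ : ∃ C : Matrix m m ℂ, ρ = Cᴴ * C := by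
    open scoped MatrixOrder in
    exact CStarAlgebra.nonneg_iff_eq_star_mul_self.1 hA.posDef.posSemidef.nonneg
  have h0 : ∀ n, ∑ k : m, ∑ q : m, (ρ * (krausMap A ^ n) (U * single k q 1 * Uᴴ) *
      (krausMap A ^ n) (single q k 1)).trace = 0 := by
    intro n
    have h := sum_trace_mul_krausMap_pow_single A n Uᴴ (ρ * U)
    simp only [hvan, mul_zero, Finset.sum_const_zero] at h
    rw [← h]
    refine Finset.sum_congr rfl fun k _ => Finset.sum_congr rfl fun q _ => ?_
    rw [← conj_krausMap_pow hz hU hUA]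
    simp only [Matrix.mul_assoc]
  have hlim : Filter.Tendsto (fun n => ∑ k : m, ∑ q : m,
      (ρ * (krausMap A ^ n) (single k q 1 - U * single k q 1 * Uᴴ) *
        (krausMap A ^ n) (single q k 1)).trace) Filter.atTop (nhds 0) := by
    rw [show (0 : ℂ) = ∑ k : m, ∑ q : m, 0 by simp]
    refine tendsto_finsetSum _ fun k _ => tendsto_finsetSum _ fun q _ => ?_
    have e : ∀ P Q : Matrix m m ℂ, (ρ * P * Q).trace =
        ∑ i, ∑ j, (C * P) i j * (Q * Cᴴ) j i := by
      intro P Q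
      have : ρ * P * Q = Cᴴ * ((C * P) * Q) := by rw [hC]; simp only [Matrix.mul_assoc]
      rw [this, trace_mul_comm, Matrix.mul_assoc]
      simp [trace, mul_apply]
    simp only [e]
    rw [show (0 : ℂ) = ∑ i : m, ∑ j : m, 0 by simp]
    refine tendsto_finsetSum _ fun i _ => tendsto_finsetSum _ fun j _ => ?_
    obtain ⟨M, hM⟩ := hA.exists_norm_mul_krausMap_pow_le hC (single q k 1)
    have h1 := hA.tendsto_krausMap_pow_sub_conj hz hU hUA hcomm (single k q 1)
      (Matrix.entryLinearMap ℂ ℂ i j ∘ₗ LinearMap.mulLeft ℂ C)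
    have h2 : Filter.Tendsto (fun n => ‖(C * (krausMap A ^ n)
        (single k q 1 - U * single k q 1 * Uᴴ)) i j‖ * M) Filter.atTop (nhds 0) := by
      simpa using h1.norm.mul_const M
    refine squeeze_zero_norm (fun n => ?_) h2
    rw [norm_mul]
    exact mul_le_mul_of_nonneg_left (hM n j i) (norm_nonneg _)
  let k₀ := Classical.arbitrary m
  have hpos : 0 < (ρ k₀ k₀).re := (Complex.pos_iff.1 hA.posDef.diag_pos).1
  have hlow : ∀ n, (ρ k₀ k₀).re ^ 2 ≤ (∑ k : m, ∑ q : m,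
      (ρ * (krausMap A ^ n) (single k q 1 - U * single k q 1 * Uᴴ) *
        (krausMap A ^ n) (single q k 1)).trace).re := by
    intro n
    have e1 : ∑ k : m, ∑ q : m,
      (ρ * (krausMap A ^ n) (single k q 1 - U * single k q 1 * Uᴴ) *
        (krausMap A ^ n) (single q k 1)).trace =
        ∑ k : m, ∑ q : m, (ρ * (((krausMap A ^ n) (single q k 1))ᴴ *
          (krausMap A ^ n) (single q k 1))).trace := by
      simp only [map_sub, Matrix.mul_sub, Matrix.sub_mul, trace_sub, Finset.sum_sub_distrib, h0,
        sub_zero]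
      refine Finset.sum_congr rfl fun k _ => Finset.sum_congr rfl fun q _ => ?_
      rw [← krausMap_pow_conjTranspose, conjTranspose_single, star_one, Matrix.mul_assoc]
    have hnn : ∀ k q : m, 0 ≤ (ρ * (((krausMap A ^ n) (single q k 1))ᴴ *
          (krausMap A ^ n) (single q k 1))).trace.re :=
      fun k q => (Complex.nonneg_iff.1 (hA.trace_mul_conjTranspose_mul_nonneg _)).1
    rw [e1, Complex.re_sum]
    simp only [Complex.re_sum]
    refine le_trans ?_ ((Finset.single_le_sum (f := fun q => (ρ *
      (((krausMap A ^ n) (single q k₀ 1))ᴴ * (krausMap A ^ n) (single q k₀ 1))).trace.re)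
      (fun q _ => hnn k₀ q) (Finset.mem_univ k₀)).trans (Finset.single_le_sum
      (f := fun k => ∑ q, (ρ *
      (((krausMap A ^ n) (single q k 1))ᴴ * (krausMap A ^ n) (single q k 1))).trace.re)
      (fun k _ => Finset.sum_nonneg fun q _ => hnn k q) (Finset.mem_univ k₀)))
    have h1 := (Complex.le_def.1 (hA.star_trace_mul_trace_le
      ((krausMap A ^ n) (single k₀ k₀ 1)))).1
    refine le_trans ?_ h1
    have h2 : (ρ * single k₀ k₀ (1 : ℂ)).trace = ρ k₀ k₀ := by
      simp [trace_mul_single]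
    rw [hA.trace_mul_krausMap_pow_eq, h2, star_mul_self_eq_norm_sq, Complex.ofReal_re]
    exact pow_le_pow_left₀ hpos.le (Complex.re_le_norm _) 2
  have hle := ge_of_tendsto' ((Complex.continuous_re.tendsto 0).comp hlim) hlow
  simp only [Complex.zero_re] at hle
  exact absurd hle (not_le.2 (pow_pos hpos 2))

end IsErgodicKraus

end Aperiodic

/-! ### Chain states generated by Kraus operators -/

section WordState

variable {d : ℕ} {m : Type*} [Fintype m] [DecidableEq m]

/-- The matrix with entries `Tr(τ A_y A_x†)` on `n` sites, `A_x` being the product of the Kraus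
operators along `x`. -/
def wordState (A : Fin d → Matrix m m ℂ) (τ : Matrix m m ℂ) (n : ℕ) :
    Matrix (Fin n → Fin d) (Fin n → Fin d) ℂ :=
  Matrix.of fun x y => (τ * (word A y * (word A x)ᴴ)).trace

variable {A : Fin d → Matrix m m ℂ}

/-- `Tr(τ A_y A_x†)` is the Gram matrix of the matrices `C A_y` if `τ = C† C`. -/
theorem wordState_posSemidef {τ : Matrix m m ℂ} (hτ : τ.PosSemidef) (n : ℕ) :
    (wordState A τ n).PosSemidef := by
  obtain ⟨C, hC⟩ : ∃ C : Matrix m m ℂ, τ = Cᴴ * C := by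
    open scoped MatrixOrder in
    exact CStarAlgebra.nonneg_iff_eq_star_mul_self.1 hτ.nonneg
  let G : Matrix (m × m) (Fin n → Fin d) ℂ := Matrix.of fun p y => (C * word A y) p.1 p.2
  have : wordState A τ n = Gᴴ * G := by
    ext x y
    have e : τ * (word A y * (word A x)ᴴ) = Cᴴ * (C * word A y * (word A x)ᴴ) := by
      rw [hC]; simp only [Matrix.mul_assoc]
    rw [wordState, of_apply, e, trace_mul_comm, Matrix.mul_assoc, ← conjTranspose_mul,
      trace_mul_comm, trace, mul_apply, Fintype.sum_prod_type, Finset.sum_comm]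
    refine Finset.sum_congr rfl fun k _ => ?_
    rw [diag_apply, mul_apply]
    rfl
  rw [this]
  exact posSemidef_conjTranspose_mul_self G

theorem sum_word_mul_conjTranspose (h : ∑ s, A s * (A s)ᴴ = 1) (n : ℕ) :
    ∑ x : Fin n → Fin d, word A x * (word A x)ᴴ = 1 := by
  induction n with
  | zero => simp [word_zero]
  | succ n ih =>
    rw [← (Fin.snocEquiv fun _ : Fin (n + 1) => Fin d).sum_comp, Fintype.sum_prod_type_right]
    rw [← ih]
    refine Finset.sum_congr rfl fun x _ => ?_
    have : ∀ s, word A ((Fin.snocEquiv fun _ : Fin (n + 1) => Fin d) (s, x)) = word A x * A s :=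
      fun s => word_snoc A x s
    simp only [this, conjTranspose_mul]
    calc ∑ s, word A x * A s * ((A s)ᴴ * (word A x)ᴴ)
        = word A x * (∑ s, A s * (A s)ᴴ) * (word A x)ᴴ := by
          simp only [Matrix.mul_sum, Matrix.sum_mul, Matrix.mul_assoc]
      _ = _ := by rw [h, Matrix.mul_one]

theorem wordState_trace (h : ∑ s, A s * (A s)ᴴ = 1) (τ : Matrix m m ℂ) (n : ℕ) :
    (wordState A τ n).trace = τ.trace := by
  simp only [trace, diag_apply, wordState, of_apply]
  change ∑ x : Fin n → Fin d, (τ * (word A x * (word A x)ᴴ)).trace = τ.trace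
  rw [← trace_sum, ← Matrix.mul_sum, sum_word_mul_conjTranspose h, Matrix.mul_one]

/-- A sequence of density matrices of the memory that is compatible with the dual of `krausMap A`
defines a state of the chain. -/
theorem wordState_mem_chainStates (h : ∑ s, A s * (A s)ᴴ = 1) {τ : ℤ → Matrix m m ℂ}
    (hτ : ∀ k, IsDensityMatrix (τ k)) (hstep : ∀ k, ∑ s, (A s)ᴴ * τ k * A s = τ (k + 1)) :
    (fun k n => wordState A (τ k) n) ∈ chainStates d := by
  refine ⟨fun k n => ⟨wordState_posSemidef (hτ k).1 n, ?_⟩, fun k n x y => ?_, fun k n x y => ?_⟩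
  · rw [wordState_trace h, (hτ k).2]
  · simp only [wordState, of_apply, word_snoc, conjTranspose_mul]
    rw [← trace_sum, ← Matrix.mul_sum]
    congr 2
    calc ∑ s, word A y * A s * ((A s)ᴴ * (word A x)ᴴ)
        = word A y * (∑ s, A s * (A s)ᴴ) * (word A x)ᴴ := by
          simp only [Matrix.mul_sum, Matrix.sum_mul, Matrix.mul_assoc]
      _ = _ := by rw [h, Matrix.mul_one]
  · simp only [wordState, of_apply, word_cons, conjTranspose_mul]
    rw [← hstep k, Matrix.sum_mul, trace_sum]
    refine Finset.sum_congr rfl fun s _ => ?_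
    calc (τ k * (A s * word A y * ((word A x)ᴴ * (A s)ᴴ))).trace
        = (τ k * (A s * word A y * (word A x)ᴴ) * (A s)ᴴ).trace := by
          simp only [Matrix.mul_assoc]
      _ = _ := by
          rw [trace_mul_comm]
          simp only [Matrix.mul_assoc]

theorem wordState_add (τ τ' : Matrix m m ℂ) (n : ℕ) :
    wordState A (τ + τ') n = wordState A τ n + wordState A τ' n := by
  ext x y
  simp [wordState, Matrix.add_mul]

theorem wordState_smul (c : ℝ) (τ : Matrix m m ℂ) (n : ℕ) :
    wordState A (c • τ) n = c • wordState A τ n := by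
  ext x y
  simp [wordState]

end WordState

/-! ### Purity excludes periodicity -/

section Purity

variable {d : ℕ} {m : Type*} [Fintype m] [DecidableEq m] {A : Fin d → Matrix m m ℂ}
  {ρ : Matrix m m ℂ}

namespace IsErgodicKraus

variable (hA : IsErgodicKraus A ρ)
include hA

theorem conj_eq_of_intertwines {z : ℂ} {U : Matrix m m ℂ} (hz : ‖z‖ = 1) (hU : Uᴴ * U = 1)
    (hUA : Intertwines A z U) : U * ρ * Uᴴ = ρ := by
  refine hA.unique _ ⟨hA.posDef.posSemidef.mul_mul_conjTranspose_same U, ?_⟩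
    (hA.invariant_conj (star_mul_self_of_norm hz) hUA)
  rw [trace_mul_comm, ← Matrix.mul_assoc, hU, Matrix.one_mul, hA.trace_eq_one]

theorem trace_mul_eq_zero_of_intertwines {z : ℂ} {U : Matrix m m ℂ} (hz : z ≠ 1)
    (hUA : Intertwines A z U) : (ρ * U).trace = 0 := by
  have h := hA.trace_mul_krausMap_eq U
  rw [hUA.krausMap_eq hA.unital, Matrix.mul_smul, trace_smul, smul_eq_mul] at h
  have h2 : (z - 1) * (ρ * U).trace = 0 := by rw [sub_mul, h, one_mul, sub_self]
  exact (mul_eq_zero.1 h2).resolve_left (sub_ne_zero.2 hz)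

/-- The Hermitian perturbation of `2 ρ` by `c U ρ + c̄ ρ U†` is positive, since it is
`(1 + c U) ρ (1 + c U)†`. Replacing `c` by `-c` exhibits `ρ` as the midpoint of two density
matrices. -/
theorem isDensityMatrix_perturbation {z : ℂ} {U : Matrix m m ℂ} (hz : ‖z‖ = 1) (hz1 : z ≠ 1)
    (hU : Uᴴ * U = 1) (hUA : Intertwines A z U) {c : ℂ} (hc : ‖c‖ = 1) :
    IsDensityMatrix ((2⁻¹ : ℝ) • ((1 + c • U) * ρ * (1 + c • U)ᴴ)) ∧
      (1 + c • U) * ρ * (1 + c • U)ᴴ =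
        (2 : ℝ) • ρ + (c • (U * ρ) + star c • (ρ * Uᴴ)) := by
  have e : (1 + c • U) * ρ * (1 + c • U)ᴴ =
        (2 : ℝ) • ρ + (c • (U * ρ) + star c • (ρ * Uᴴ)) := by
    have h1 : (c • U) * ρ * (c • U)ᴴ = ρ := by
      rw [conjTranspose_smul, Matrix.smul_mul, Matrix.smul_mul, Matrix.mul_smul, smul_smul,
        hA.conj_eq_of_intertwines hz hU hUA, mul_comm, star_mul_self_of_norm hc, one_smul]
    calc (1 + c • U) * ρ * (1 + c • U)ᴴ
        = ρ + c • (U * ρ) + star c • (ρ * Uᴴ) + (c • U) * ρ * (c • U)ᴴ := by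
          simp only [conjTranspose_add, conjTranspose_one, Matrix.add_mul, Matrix.mul_add,
            Matrix.one_mul, Matrix.mul_one, conjTranspose_smul, Matrix.smul_mul,
            Matrix.mul_smul, smul_add]
          abel
      _ = _ := by
          rw [h1, two_smul]
          abel
  have t1 : (U * ρ).trace = 0 := by
    rw [trace_mul_comm, hA.trace_mul_eq_zero_of_intertwines hz1 hUA]
  have t2 : (ρ * Uᴴ).trace = 0 := by
    rw [← hA.posDef.1.eq, ← conjTranspose_mul, trace_conjTranspose, t1, star_zero]
  refine ⟨⟨(hA.posDef.posSemidef.mul_mul_conjTranspose_same _).smul (by positivity), ?_⟩, e⟩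
  rw [e, trace_smul, trace_add, trace_add, trace_smul, trace_smul, trace_smul, t1, t2,
    hA.trace_eq_one]
  norm_num

/-- The dual of `krausMap A` rotates the phase of the perturbation, so that the perturbations
with the phases `c z⁻ᵏ` at the sites `k` are consistent with each other. -/
theorem sum_conj_one_add_smul {z : ℂ} {U : Matrix m m ℂ} (hz : ‖z‖ = 1)
    (hUA : Intertwines A z U) (c : ℂ) :
    ∑ s, (A s)ᴴ * ((1 + c • U) * ρ * (1 + c • U)ᴴ) * A s =
      (1 + (c * z⁻¹) • U) * ρ * (1 + (c * z⁻¹) • U)ᴴ := by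
  have hz0 : z ≠ 0 := by rintro rfl; simp at hz
  have e1 : ∀ s, (A s)ᴴ * (1 + c • U) = (1 + (c * z⁻¹) • U) * (A s)ᴴ := by
    intro s
    rw [Matrix.mul_add, Matrix.add_mul, Matrix.mul_one, Matrix.one_mul, Matrix.mul_smul,
      Matrix.smul_mul, hUA s, smul_smul, mul_assoc, inv_mul_cancel₀ hz0, mul_one]
  have e2 : ∀ s, (1 + c • U)ᴴ * A s = A s * (1 + (c * z⁻¹) • U)ᴴ := by
    intro s
    have := congrArg Matrix.conjTranspose (e1 s)
    rwa [conjTranspose_mul, conjTranspose_mul, conjTranspose_conjTranspose] at this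
  calc ∑ s, (A s)ᴴ * ((1 + c • U) * ρ * (1 + c • U)ᴴ) * A s
      = ∑ s, (1 + (c * z⁻¹) • U) * ((A s)ᴴ * ρ * A s) * (1 + (c * z⁻¹) • U)ᴴ :=
        Finset.sum_congr rfl fun s _ => by
          calc (A s)ᴴ * ((1 + c • U) * ρ * (1 + c • U)ᴴ) * A s
              = ((A s)ᴴ * (1 + c • U)) * ρ * ((1 + c • U)ᴴ * A s) := by
                simp only [Matrix.mul_assoc]
            _ = _ := by
                rw [e1, e2]
                simp only [Matrix.mul_assoc]
    _ = _ := by rw [← Matrix.sum_mul, ← Matrix.mul_sum, hA.invariant]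

/-- Purity of the state with entries `Tr(ρ A_y A_x†)`, applied to its decomposition into the two
states that arise from the perturbations `ρ ± (c U ρ + c̄ ρ U†) / 2`. -/
theorem trace_perturbation_eq_zero {z : ℂ} {U : Matrix m m ℂ} (hz : ‖z‖ = 1) (hz1 : z ≠ 1)
    (hU : Uᴴ * U = 1) (hUA : Intertwines A z U)
    (hpure : IsPureChainState fun _ n => wordState A ρ n) {c : ℂ} (hc : ‖c‖ = 1) (n : ℕ) :
    wordState A (c • (U * ρ) + star c • (ρ * Uᴴ)) n = 0 := by
  have hz0 : z ≠ 0 := by rintro rfl; simp at hz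
  let τ : ℂ → ℤ → Matrix m m ℂ := fun c k =>
    (2⁻¹ : ℝ) • ((1 + (c * z⁻¹ ^ k) • U) * ρ * (1 + (c * z⁻¹ ^ k) • U)ᴴ)
  have hnorm : ∀ (c : ℂ) (k : ℤ), ‖c‖ = 1 → ‖c * z⁻¹ ^ k‖ = 1 := by
    intro c k hc
    simp [hc, hz]
  have hmem : ∀ c : ℂ, ‖c‖ = 1 → (fun k n => wordState A (τ c k) n) ∈ chainStates d := by
    intro c hc
    refine wordState_mem_chainStates hA.unital
      (fun k => (hA.isDensityMatrix_perturbation hz hz1 hU hUA (hnorm c k hc)).1) fun k => ?_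
    simp only [τ, Matrix.mul_smul, Matrix.smul_mul, ← Finset.smul_sum]
    rw [hA.sum_conj_one_add_smul hz hUA, zpow_add_one₀ (inv_ne_zero hz0), mul_assoc c]
  have hτ : ∀ (c : ℂ) (k : ℤ), ‖c‖ = 1 → τ c k = ρ + (2⁻¹ : ℝ) •
      ((c * z⁻¹ ^ k) • (U * ρ) + star (c * z⁻¹ ^ k) • (ρ * Uᴴ)) := by
    intro c k hc
    simp only [τ]
    rw [(hA.isDensityMatrix_perturbation hz hz1 hU hUA (hnorm c k hc)).2, smul_add, smul_smul]
    norm_num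
  have hseg : (fun (_ : ℤ) n => wordState A ρ n) ∈
      openSegment ℝ (fun k n => wordState A (τ c k) n) (fun k n => wordState A (τ (-c) k) n) := by
    refine ⟨2⁻¹, 2⁻¹, by norm_num, by norm_num, by norm_num, ?_⟩
    funext k n
    simp only [Pi.add_apply, Pi.smul_apply]
    rw [← wordState_smul, ← wordState_smul, ← wordState_add, hτ c k hc,
      hτ (-c) k (by rwa [norm_neg])]
    congr 1
    simp only [neg_mul, neg_smul, star_neg, smul_add, smul_neg]
    have h2 : (2⁻¹ : ℝ) • ρ + (2⁻¹ : ℝ) • ρ = ρ := by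
      rw [← add_smul]; norm_num
    conv_rhs => rw [← h2]
    abel
  have hext := hpure.2 (hmem c hc) (hmem (-c) (by rwa [norm_neg])) hseg
  have h0 : wordState A (τ c 0) n = wordState A ρ n := congrFun (congrFun hext 0) n
  rw [hτ c 0 hc, wordState_add, wordState_smul, add_eq_left, zpow_zero, mul_one] at h0
  exact (smul_eq_zero.1 h0).resolve_left (by norm_num)

/-- In a pure state the functional `ρ U` vanishes on all products of Kraus operators. -/
theorem trace_mul_word_eq_zero {z : ℂ} {U : Matrix m m ℂ} (hz : ‖z‖ = 1) (hz1 : z ≠ 1)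
    (hU : Uᴴ * U = 1) (hUA : Intertwines A z U)
    (hpure : IsPureChainState fun _ n => wordState A ρ n) (n : ℕ) (x y : Fin n → Fin d) :
    (ρ * U * (word A x * (word A y)ᴴ)).trace = 0 := by
  have hcom : ρ * U = U * ρ := by
    conv_lhs => rw [← hA.conj_eq_of_intertwines hz hU hUA]
    rw [Matrix.mul_assoc, hU, Matrix.mul_one]
  have key : ∀ c : ℂ, ‖c‖ = 1 → c * (U * ρ * (word A x * (word A y)ᴴ)).trace +
      star c * (ρ * Uᴴ * (word A x * (word A y)ᴴ)).trace = 0 := by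
    intro c hc
    have h := congrFun (congrFun
      (hA.trace_perturbation_eq_zero hz hz1 hU hUA hpure hc n) y) x
    simpa [wordState, Matrix.add_mul] using h
  -- the phases `c = 1` and `c = I` separate the two terms
  have k1 := key 1 (by simp)
  have k2 := key Complex.I (by simp)
  simp only [star_one, one_mul] at k1
  have k3 : star Complex.I = -Complex.I := Complex.conj_I
  rw [k3, neg_mul, ← sub_eq_add_neg, ← mul_sub] at k2
  have k4 := (mul_eq_zero.1 k2).resolve_left Complex.I_ne_zero
  rw [hcom]
  linear_combination (k1 + k4) / 2

/-- A pure state has `1` as its only peripheral eigenvalue. -/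
theorem eq_one_of_pure (hpure : IsPureChainState fun _ n => wordState A ρ n) (w : ℂ)
    (X : Matrix m m ℂ) (hw : ‖w‖ = 1) (hX : X ≠ 0) (hXA : Intertwines A w X) : w = 1 := by
  obtain ⟨z, U, hz, hU, hUA, hgen⟩ := hA.exists_generator
  by_cases hz1 : z = 1
  · exact (hgen w X hw hX hXA).2 hz1
  · exact (hA.false_of_trace_word_eq_zero hz hU hUA (fun w X hw hX hXA => (hgen w X hw hX hXA).1)
      (hA.trace_mul_word_eq_zero hz hz1 hU hUA hpure)).elim

end IsErgodicKraus

end Purity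

/-! ### Kraus operators of a finitely correlated state -/

section Generated

variable {d b : ℕ}

/-- The Kraus operators `A s`, the blocks of `V = (A 0, …, A (d - 1))`. -/
def siteMatrix (V : Matrix (Fin b) (Fin d × Fin b) ℂ) (s : Fin d) : Matrix (Fin b) (Fin b) ℂ :=
  Matrix.of fun i j => V i (s, j)

theorem transferMap_kronecker (V : Matrix (Fin b) (Fin d × Fin b) ℂ)
    (M : Matrix (Fin d) (Fin d) ℂ) (B : Matrix (Fin b) (Fin b) ℂ) :
    transferMap V (M ⊗ₖ B) =
      ∑ s, ∑ t, M s t • (siteMatrix V s * B * (siteMatrix V t)ᴴ) := by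
  ext i j
  simp only [transferMap, mul_apply, Fintype.sum_prod_type, Matrix.sum_apply, Matrix.smul_apply,
    kroneckerMap_apply, conjTranspose_apply, siteMatrix, of_apply, Finset.sum_mul, smul_eq_mul,
    Finset.mul_sum]
  calc _ = ∑ t, ∑ s, ∑ l, ∑ k, V i (s, k) * (M s t * B k l) * star (V j (t, l)) :=
        Finset.sum_congr rfl fun t _ => Finset.sum_comm
    _ = ∑ s, ∑ t, ∑ l, ∑ k, V i (s, k) * (M s t * B k l) * star (V j (t, l)) := Finset.sum_comm
    _ = _ := by
        refine Finset.sum_congr rfl fun s _ => Finset.sum_congr rfl fun t _ =>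
          Finset.sum_congr rfl fun l _ => Finset.sum_congr rfl fun k _ => ?_
        ring

theorem reducedTransferMap_eq (V : Matrix (Fin b) (Fin d × Fin b) ℂ)
    (B : Matrix (Fin b) (Fin b) ℂ) : reducedTransferMap V B = krausMap (siteMatrix V) B := by
  rw [reducedTransferMap, transferMap_kronecker, krausMap_apply]
  simp [one_apply, ite_smul]

theorem isInvariant_iff {V : Matrix (Fin b) (Fin d × Fin b) ℂ} {σ : Matrix (Fin b) (Fin b) ℂ} :
    IsInvariant V σ ↔ ∑ s, (siteMatrix V s)ᴴ * σ * siteMatrix V s = σ := by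
  rw [IsInvariant, ext_iff_trace_mul_right]
  simp only [reducedTransferMap_eq, trace_mul_krausMap]

theorem Generates.isErgodicKraus {V : Matrix (Fin b) (Fin d × Fin b) ℂ}
    {ρ : Matrix (Fin b) (Fin b) ℂ} {ω : LocalFamily d} (h : Generates V ρ ω) :
    IsErgodicKraus (siteMatrix V) ρ where
  unital := by
    have h1 := reducedTransferMap_eq V 1
    rw [reducedTransferMap, one_kronecker_one, transferMap, Matrix.mul_one, h.coisometry,
      krausMap_apply] at h1
    simpa using h1.symm
  posDef := h.density.1.posDef_iff_isUnit.2 ((isUnit_iff_isUnit_det _).2 h.nonsingular)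
  trace_eq_one := h.density.2
  invariant := isInvariant_iff.1 h.invariant
  unique σ hσ hinv := h.unique σ hσ (isInvariant_iff.2 hinv)

theorem iteratedTransfer_single (V : Matrix (Fin b) (Fin d × Fin b) ℂ) (n : ℕ)
    (x y : Fin n → Fin d) :
    iteratedTransfer V n (fun i => single (x i) (y i) 1) =
      word (siteMatrix V) x * (word (siteMatrix V) y)ᴴ := by
  induction n with
  | zero => simp [iteratedTransfer, word_zero]
  | succ n ih =>
    rw [iteratedTransfer, ih, transferMap_kronecker, Finset.sum_eq_single (x 0),
      Finset.sum_eq_single (y 0)]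
    · have hx := word_cons (siteMatrix V) (x 0) (Fin.tail x)
      have hy := word_cons (siteMatrix V) (y 0) (Fin.tail y)
      rw [Fin.cons_self_tail] at hx hy
      rw [hx, hy, conjTranspose_mul, single_apply_same, one_smul]
      simp only [Matrix.mul_assoc]
      rfl
    · intro t _ ht
      simp [ht.symm]
    · simp
    · intro s _ hs
      refine Finset.sum_eq_zero fun t _ => ?_
      simp [hs.symm]
    · simp

theorem elementaryTensor_single {n : ℕ} (x y : Fin n → Fin d) :
    elementaryTensor (fun i => single (x i) (y i) (1 : ℂ)) = single x y 1 := by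
  ext u v
  simp only [elementaryTensor, of_apply, single_apply, funext_iff, ← forall_and]
  rw [Fintype.prod_ite_zero]
  simp

/-- The expectations of elementary tensors of matrix units are the entries of the state. -/
theorem Generates.eq_wordState {V : Matrix (Fin b) (Fin d × Fin b) ℂ}
    {ρ : Matrix (Fin b) (Fin b) ℂ} {ω : LocalFamily d} (h : Generates V ρ ω)
    (hinv : IsTranslationInvariant ω) : ω = fun _ n => wordState (siteMatrix V) ρ n := by
  have h1 : ∀ n, ω 1 n = wordState (siteMatrix V) ρ n := by
    intro n
    ext x y
    have := h.expectation n fun i => single (y i) (x i) 1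
    rw [iteratedTransfer_single, elementaryTensor_single, trace_mul_single] at this
    simpa [wordState] using this
  have h2 : ∀ (k : ℤ) n, ω k n = ω 0 n := by
    intro k n
    induction k with
    | zero => rfl
    | succ k ih => rw [hinv, ih]
    | pred k ih => rw [← ih, ← hinv (-(k : ℤ) - 1), sub_add_cancel]
  funext k n
  rw [h2, ← h2 1, h1]

end Generated

/-! ### Encoding the memory into the spins and recovering it -/

section Recovery

variable {d b : ℕ}

theorem one_kronecker_conj_apply {α β γ : Type*} [Fintype α] [DecidableEq α] [Fintype β]
    (K : Matrix γ β ℂ) (M : Matrix (α × β) (α × β) ℂ) (s t : α) (x y : γ) :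
    (((1 : Matrix α α ℂ) ⊗ₖ K) * M * ((1 : Matrix α α ℂ) ⊗ₖ K)ᴴ) (s, x) (t, y) =
      (K * (Matrix.of fun i j => M (s, i) (t, j)) * Kᴴ) x y := by
  simp [mul_apply, Fintype.sum_prod_type, one_apply, Finset.sum_mul, apply_ite (starRingEnd ℂ)]

theorem spinMemoryState_apply (V : Matrix (Fin b) (Fin d × Fin b) ℂ)
    (ρ : Matrix (Fin b) (Fin b) ℂ) (s t : Fin d) :
    (Matrix.of fun i j => spinMemoryState V ρ (s, i) (t, j)) =
      (siteMatrix V s)ᴴ * ρ * siteMatrix V t := rfl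

theorem isDensityMatrix_spinMemoryState {V : Matrix (Fin b) (Fin d × Fin b) ℂ}
    {ρ : Matrix (Fin b) (Fin b) ℂ} (hV : V * Vᴴ = 1) (hρ : IsDensityMatrix ρ) :
    IsDensityMatrix (spinMemoryState V ρ) := by
  refine ⟨hρ.1.conjTranspose_mul_mul_same V, ?_⟩
  rw [spinMemoryState, trace_mul_comm, ← Matrix.mul_assoc, hV, Matrix.one_mul, hρ.2]

theorem isDensityMatrix_splitFirst {n : ℕ}
    {M : Matrix (Fin (n + 1) → Fin d) (Fin (n + 1) → Fin d) ℂ} (hM : IsDensityMatrix M) :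
    IsDensityMatrix (splitFirst M) := by
  refine ⟨hM.1.submatrix _, ?_⟩
  rw [← hM.2]
  exact (Fin.consEquiv fun _ : Fin (n + 1) => Fin d).sum_comp fun x => M x x

variable (A : Fin d → Matrix (Fin b) (Fin b) ℂ)

/-- The operator from two copies of the memory to `n` spins that sends the matrix unit with label
`(i, k)` to the vector with components `star (A_x i k)`. -/
def encoding (n : ℕ) : Matrix (Fin n → Fin d) (Fin b × Fin b) ℂ :=
  Matrix.of fun x p => star (word A x p.1 p.2)

/-- The Kraus operators of the channel from the memory to `n` spins. -/
def encodingKraus (n : ℕ) (k : Fin b) : Matrix (Fin n → Fin d) (Fin b) ℂ :=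
  Matrix.of fun x i => star (word A x i k)

theorem gram_encoding_apply (n : ℕ) (p q : Fin b × Fin b) :
    ((encoding A n)ᴴ * encoding A n) p q = (krausMap A ^ n) (single p.2 q.2 1) p.1 q.1 := by
  rw [krausMap_pow_apply, Matrix.sum_apply, mul_apply]
  refine Finset.sum_congr rfl fun x _ => ?_
  simp [encoding, mul_apply, single_apply, ite_and]

theorem sum_encodingKraus (h : ∑ s, A s * (A s)ᴴ = 1) (n : ℕ) :
    ∑ k, (encodingKraus A n k)ᴴ * encodingKraus A n k = 1 := by
  rw [← sum_word_mul_conjTranspose h n]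
  ext i j
  simp only [Matrix.sum_apply, mul_apply]
  rw [Finset.sum_comm]
  simp [encodingKraus]

/-- The state of `n + 1` spins arises from the spin-memory state by encoding the memory. -/
theorem splitFirst_wordState (V : Matrix (Fin b) (Fin d × Fin b) ℂ)
    (ρ : Matrix (Fin b) (Fin b) ℂ) (n : ℕ) :
    splitFirst (wordState (siteMatrix V) ρ (n + 1)) =
      ∑ k, ((1 : Matrix (Fin d) (Fin d) ℂ) ⊗ₖ encodingKraus (siteMatrix V) n k) *
        spinMemoryState V ρ *
        ((1 : Matrix (Fin d) (Fin d) ℂ) ⊗ₖ encodingKraus (siteMatrix V) n k)ᴴ := by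
  ext ⟨s, x⟩ ⟨t, y⟩
  rw [Matrix.sum_apply]
  simp only [one_kronecker_conj_apply, spinMemoryState_apply]
  set A := siteMatrix V
  simp only [splitFirst, submatrix_apply, wordState, of_apply, word_cons, conjTranspose_mul]
  calc (ρ * (A t * word A y * ((word A x)ᴴ * (A s)ᴴ))).trace
      = ((word A x)ᴴ * ((A s)ᴴ * ρ * A t) * word A y).trace := by
        have : ρ * (A t * word A y * ((word A x)ᴴ * (A s)ᴴ)) =
          (ρ * A t * word A y) * ((word A x)ᴴ * (A s)ᴴ) := by simp only [Matrix.mul_assoc]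
        rw [this, trace_mul_comm]
        simp only [Matrix.mul_assoc]
    _ = _ := by
        refine Finset.sum_congr rfl fun k _ => ?_
        simp [mul_apply, encodingKraus, Finset.sum_mul, Finset.mul_sum]

variable {A}

/-- If the encoding `Γ` is injective, its left inverse `R = (Γ† Γ)⁻¹ Γ†`, weighted by a root `C` of
`ρᵀ`, recovers the memory exactly: the operators obtained from `(1 ⊗ C) R` map every Kraus operator
of the encoding to a multiple of the identity. Their norm is controlled by the distance of `Γ† Γ`
from its limit `1 ⊗ ρᵀ`. -/
theorem exists_recovery {ρ : Matrix (Fin b) (Fin b) ℂ} (hρ : IsDensityMatrix ρ) {n : ℕ}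
    (hΓ : ((encoding A n)ᴴ * encoding A n).PosDef) :
    ∃ L : Fin b → Matrix (Fin b) (Fin n → Fin d) ℂ,
      (∀ M : Matrix (Fin d × Fin b) (Fin d × Fin b) ℂ,
        M = ∑ j, ((1 : Matrix (Fin d) (Fin d) ℂ) ⊗ₖ L j) *
          (∑ k, ((1 : Matrix (Fin d) (Fin d) ℂ) ⊗ₖ encodingKraus A n k) * M *
            ((1 : Matrix (Fin d) (Fin d) ℂ) ⊗ₖ encodingKraus A n k)ᴴ) *
          ((1 : Matrix (Fin d) (Fin d) ℂ) ⊗ₖ L j)ᴴ) ∧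
      ∀ κ : ℝ, 0 ≤ κ →
        (κ • ((encoding A n)ᴴ * encoding A n) -
          (1 : Matrix (Fin b) (Fin b) ℂ) ⊗ₖ ρᵀ).PosSemidef →
        (κ • (1 : Matrix (Fin n → Fin d) (Fin n → Fin d) ℂ) - ∑ j, (L j)ᴴ * L j).PosSemidef := by
  set Γ := encoding A n with hΓdef
  set G := Γᴴ * Γ with hG
  obtain ⟨C, hC⟩ : ∃ C : Matrix (Fin b) (Fin b) ℂ, ρᵀ = Cᴴ * C := by
    open scoped MatrixOrder in
    exact CStarAlgebra.nonneg_iff_eq_star_mul_self.1 hρ.1.transpose.nonneg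
  have hdet : IsUnit G.det := (isUnit_iff_isUnit_det _).1 hΓ.isUnit
  set R := G⁻¹ * Γᴴ with hR
  have hRΓ : R * Γ = 1 := by rw [hR, Matrix.mul_assoc, ← hG, nonsing_inv_mul _ hdet]
  set T := ((1 : Matrix (Fin b) (Fin b) ℂ) ⊗ₖ C) * R with hT
  let L : Fin b → Matrix (Fin b) (Fin n → Fin d) ℂ := fun j => Matrix.of fun i x => T (i, j) x
  -- `L j * encodingKraus A n k` is a block of `(1 ⊗ C) R Γ = 1 ⊗ C`
  have hLK : ∀ j k, L j * encodingKraus A n k = C j k • (1 : Matrix (Fin b) (Fin b) ℂ) := by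
    intro j k
    ext i i'
    have h1 : (L j * encodingKraus A n k) i i' = (T * Γ) (i, j) (i', k) := rfl
    rw [h1, hT, Matrix.mul_assoc, hRΓ, Matrix.mul_one, kroneckerMap_apply, Matrix.smul_apply,
      smul_eq_mul, mul_comm]
  have hLL : ∑ j, (L j)ᴴ * L j = Rᴴ * ((1 : Matrix (Fin b) (Fin b) ℂ) ⊗ₖ ρᵀ) * R := by
    have h1 : ∑ j, (L j)ᴴ * L j = Tᴴ * T := by
      ext x y
      rw [Matrix.sum_apply]
      simp only [mul_apply, Fintype.sum_prod_type]
      rw [Finset.sum_comm]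
      rfl
    rw [h1, hT, conjTranspose_mul, conjTranspose_kronecker, conjTranspose_one, hC]
    have h2 : ((1 : Matrix (Fin b) (Fin b) ℂ) ⊗ₖ (Cᴴ * C)) =
        ((1 : Matrix (Fin b) (Fin b) ℂ) ⊗ₖ Cᴴ) * ((1 : Matrix (Fin b) (Fin b) ℂ) ⊗ₖ C) := by
      rw [← mul_kronecker_mul, Matrix.one_mul]
    rw [h2]
    simp only [Matrix.mul_assoc]
  refine ⟨L, fun M => ?_, fun κ hκ hle => ?_⟩
  · have h1 : ∀ j k, ((1 : Matrix (Fin d) (Fin d) ℂ) ⊗ₖ L j) *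
        (((1 : Matrix (Fin d) (Fin d) ℂ) ⊗ₖ encodingKraus A n k) * M *
          ((1 : Matrix (Fin d) (Fin d) ℂ) ⊗ₖ encodingKraus A n k)ᴴ) *
          ((1 : Matrix (Fin d) (Fin d) ℂ) ⊗ₖ L j)ᴴ =
        (star (C j k) * C j k) • M := by
      intro j k
      have h2 : ((1 : Matrix (Fin d) (Fin d) ℂ) ⊗ₖ L j) *
          ((1 : Matrix (Fin d) (Fin d) ℂ) ⊗ₖ encodingKraus A n k) =
          C j k • 1 := by
        rw [← mul_kronecker_mul, hLK, Matrix.one_mul, kronecker_smul, one_kronecker_one]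
      calc _ = (((1 : Matrix (Fin d) (Fin d) ℂ) ⊗ₖ L j) *
              ((1 : Matrix (Fin d) (Fin d) ℂ) ⊗ₖ encodingKraus A n k)) * M *
            (((1 : Matrix (Fin d) (Fin d) ℂ) ⊗ₖ L j) *
              ((1 : Matrix (Fin d) (Fin d) ℂ) ⊗ₖ encodingKraus A n k))ᴴ := by
            rw [conjTranspose_mul]
            simp only [Matrix.mul_assoc]
        _ = _ := by
            rw [h2, conjTranspose_smul, conjTranspose_one, Matrix.smul_mul, Matrix.mul_smul,
              Matrix.one_mul, Matrix.mul_one, smul_smul]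
    have h3 : ∑ j, ∑ k, star (C j k) * C j k = 1 := by
      have h4 : (ρᵀ).trace = 1 := by rw [trace_transpose, hρ.2]
      rw [hC] at h4
      rw [← h4, Finset.sum_comm]
      rfl
    simp only [Matrix.mul_sum, Matrix.sum_mul, h1, ← Finset.sum_smul, h3, one_smul]
  · rw [hLL]
    -- the orthogonal projection onto the range of `Γ`
    set P := Γ * G⁻¹ * Γᴴ with hP
    have hRR : Rᴴ * G * R = P := by
      rw [hR, conjTranspose_mul, conjTranspose_conjTranspose, conjTranspose_nonsing_inv, hΓ.1.eq,
        Matrix.mul_assoc (Γ * G⁻¹), ← Matrix.mul_assoc G, mul_nonsing_inv _ hdet, Matrix.one_mul]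
    have hPh : Pᴴ = P := by
      rw [hP, conjTranspose_mul, conjTranspose_mul, conjTranspose_conjTranspose,
        conjTranspose_nonsing_inv, hΓ.1.eq, Matrix.mul_assoc]
    have hPP : P * P = P := by
      calc P * P = Γ * G⁻¹ * (Γᴴ * Γ) * G⁻¹ * Γᴴ := by
            rw [hP]; simp only [Matrix.mul_assoc]
        _ = P := by rw [← hG, nonsing_inv_mul_cancel_right _ _ hdet]
    have hproj : (1 - P).PosSemidef := by
      have : 1 - P = (1 - P)ᴴ * (1 - P) := by
        rw [conjTranspose_sub, conjTranspose_one, hPh, Matrix.mul_sub, Matrix.sub_mul,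
          Matrix.sub_mul, hPP]
        simp
      rw [this]
      exact posSemidef_conjTranspose_mul_self _
    -- `κ - R† (1 ⊗ ρᵀ) R = κ (1 - P) + R† (κ Γ† Γ - 1 ⊗ ρᵀ) R`
    have h1 := hle.conjTranspose_mul_mul_same R
    have h2 := (hproj.smul hκ).add h1
    convert h2 using 1
    rw [Matrix.mul_sub, Matrix.sub_mul, Matrix.mul_smul, Matrix.smul_mul, hRR, smul_sub]
    abel

end Recovery

/-! ### Perturbation of positive definite matrices -/

section Perturbation

variable {γ : Type*} [Fintype γ] [DecidableEq γ]

theorem exists_pos_sub_smul_one_posSemidef [Nonempty γ] {G : Matrix γ γ ℂ} (hG : G.PosDef) :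
    ∃ g : ℝ, 0 < g ∧ (G - g • (1 : Matrix γ γ ℂ)).PosSemidef := by
  obtain ⟨i₀, hi₀⟩ := Finite.exists_min hG.1.eigenvalues
  refine ⟨hG.1.eigenvalues i₀, hG.eigenvalues_pos i₀, ?_⟩
  set U := hG.1.eigenvectorUnitary
  have h1 : G - hG.1.eigenvalues i₀ • (1 : Matrix γ γ ℂ) =
      (U : Matrix γ γ ℂ) *
        diagonal (fun i => ((hG.1.eigenvalues i - hG.1.eigenvalues i₀ : ℝ) : ℂ)) *
        (U : Matrix γ γ ℂ)ᴴ := by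
    have h2 : diagonal (fun i => ((hG.1.eigenvalues i - hG.1.eigenvalues i₀ : ℝ) : ℂ)) =
        diagonal (RCLike.ofReal ∘ hG.1.eigenvalues) -
          hG.1.eigenvalues i₀ • (1 : Matrix γ γ ℂ) := by
      ext i j
      by_cases h : i = j
      · subst h; simp
      · simp [h]
    have h3 : (U : Matrix γ γ ℂ) * (U : Matrix γ γ ℂ)ᴴ = 1 := Unitary.coe_mul_star_self U
    have h4 := hG.1.spectral_theorem
    rw [Unitary.conjStarAlgAut_apply] at h4
    rw [h2, Matrix.mul_sub, Matrix.sub_mul, Matrix.mul_smul, Matrix.smul_mul, Matrix.mul_one, h3]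
    exact congrArg (· - hG.1.eigenvalues i₀ • (1 : Matrix γ γ ℂ)) h4
  rw [h1]
  refine (PosSemidef.diagonal fun i => ?_).mul_mul_conjTranspose_same _
  have : 0 ≤ hG.1.eigenvalues i - hG.1.eigenvalues i₀ := sub_nonneg.2 (hi₀ i)
  exact Complex.zero_le_real.2 this

theorem smul_one_add_posSemidef {E : Matrix γ γ ℂ} (hE : E.IsHermitian) {δ : ℝ}
    (h : ∀ i j, ‖E i j‖ ≤ δ) :
    ((Fintype.card γ * δ) • (1 : Matrix γ γ ℂ) + E).PosSemidef := by
  have hherm : ((Fintype.card γ * δ) • (1 : Matrix γ γ ℂ) + E).IsHermitian :=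
    (isHermitian_one.smul (IsSelfAdjoint.all _)).add hE
  refine PosSemidef.of_dotProduct_mulVec_nonneg hherm fun x => ?_
  have him := hherm.im_star_dotProduct_mulVec_self x
  refine Complex.nonneg_iff.2 ⟨?_, him.symm⟩
  -- `|x i| |x j| ≤ (|x i| ^ 2 + |x j| ^ 2) / 2` in every entry of the quadratic form
  have h1 : ∀ i j, -(δ * ((‖x i‖ ^ 2 + ‖x j‖ ^ 2) / 2)) ≤ (star (x i) * (E i j * x j)).re := by
    intro i j
    have h2 : ‖star (x i) * (E i j * x j)‖ ≤ δ * (‖x i‖ * ‖x j‖) := by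
      rw [norm_mul, norm_mul, norm_star]
      calc ‖x i‖ * (‖E i j‖ * ‖x j‖) = ‖E i j‖ * (‖x i‖ * ‖x j‖) := by ring
        _ ≤ _ := mul_le_mul_of_nonneg_right (h i j) (by positivity)
    have h3 := (abs_le.1 (Complex.abs_re_le_norm (star (x i) * (E i j * x j)))).1
    have hδ : 0 ≤ δ := (norm_nonneg _).trans (h i j)
    have h4 : ‖x i‖ * ‖x j‖ ≤ (‖x i‖ ^ 2 + ‖x j‖ ^ 2) / 2 := by
      nlinarith [sq_nonneg (‖x i‖ - ‖x j‖)]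
    have h5 := mul_le_mul_of_nonneg_left h4 hδ
    linarith
  have h6 : star x ⬝ᵥ (((Fintype.card γ * δ) • (1 : Matrix γ γ ℂ) + E) *ᵥ x) =
      ((Fintype.card γ * δ * ∑ i, ‖x i‖ ^ 2 : ℝ) : ℂ) +
        ∑ i, ∑ j, star (x i) * (E i j * x j) := by
    rw [add_mulVec, dotProduct_add, smul_mulVec, one_mulVec, dotProduct_smul]
    congr 1
    · simp only [dotProduct, Pi.star_apply, star_mul_self_eq_norm_sq]
      rw [Complex.real_smul]
      push_cast
      rfl
    · simp [dotProduct, mulVec, Finset.mul_sum]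
  have h7 : ∑ i, ∑ j, -(δ * ((‖x i‖ ^ 2 + ‖x j‖ ^ 2) / 2)) =
      -(Fintype.card γ * δ * ∑ i, ‖x i‖ ^ 2) := by
    have : ∀ i j, -(δ * ((‖x i‖ ^ 2 + ‖x j‖ ^ 2) / 2)) =
        -(δ / 2) * ‖x i‖ ^ 2 + -(δ / 2) * ‖x j‖ ^ 2 := fun i j => by ring
    simp only [this, Finset.sum_add_distrib, Finset.sum_const, Finset.card_univ, nsmul_eq_mul,
      ← Finset.mul_sum]
    ring
  change 0 ≤ (star x ⬝ᵥ (((Fintype.card γ * δ) • (1 : Matrix γ γ ℂ) + E) *ᵥ x)).re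
  rw [h6, Complex.add_re, Complex.ofReal_re, Complex.re_sum]
  simp only [Complex.re_sum]
  have h8 := Finset.sum_le_sum fun i (_ : i ∈ Finset.univ) =>
    Finset.sum_le_sum fun j (_ : j ∈ Finset.univ) => h1 i j
  rw [h7] at h8
  linarith

/-- A Hermitian matrix `M` that is entrywise `δ`-close to the positive definite matrix `G` satisfies
`G ≤ (1 + O(δ)) M`, and is positive definite, if `δ` is small. -/
theorem exists_le_smul_of_close [Nonempty γ] {G : Matrix γ γ ℂ} (hG : G.PosDef) :
    ∃ K : ℝ, 0 < K ∧ ∀ (M : Matrix γ γ ℂ) (δ : ℝ), M.IsHermitian → 0 ≤ δ →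
      (∀ i j, ‖(M - G) i j‖ ≤ δ) → K * δ ≤ 1 / 2 →
        M.PosDef ∧ ((1 + 2 * (K * δ)) • M - G).PosSemidef := by
  obtain ⟨g, hg, hgG⟩ := exists_pos_sub_smul_one_posSemidef hG
  have hcard : (0 : ℝ) < Fintype.card γ := by exact_mod_cast Fintype.card_pos
  refine ⟨Fintype.card γ / g, by positivity, fun M δ hM hδ hclose hsmall => ?_⟩
  set η := Fintype.card γ / g * δ with hη
  have hη0 : 0 ≤ η := by positivity
  have h1 := smul_one_add_posSemidef (hM.sub hG.1) hclose
  have h2 : (M - (1 - η) • G).PosSemidef := by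
    have h3 := h1.add (hgG.smul hη0)
    convert h3 using 1
    have : η * g = Fintype.card γ * δ := by rw [hη]; field_simp
    rw [smul_sub, smul_smul, this, sub_smul, one_smul]
    abel
  refine ⟨?_, ?_⟩
  · have h3 := PosDef.posSemidef_add h2 (hG.smul (show 0 < 1 - η by linarith))
    rwa [sub_add_cancel] at h3
  · have h3 := (h2.smul (show 0 ≤ 1 + 2 * η by linarith)).add
      (hG.posSemidef.smul (show 0 ≤ η * (1 - 2 * η) from mul_nonneg hη0 (by linarith)))
    convert h3 using 1
    rw [smul_sub, smul_smul, sub_add, ← sub_smul]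
    congr 1
    have : (1 + 2 * η) * (1 - η) - η * (1 - 2 * η) = 1 := by ring
    rw [this, one_smul]

end Perturbation

/-! ### Comparison of the spin-spin and the spin-memory entanglement -/

section Comparison

variable {d b : ℕ} {V : Matrix (Fin b) (Fin d × Fin b) ℂ} {ρ : Matrix (Fin b) (Fin b) ℂ}
  {ω : LocalFamily d}

/-- The Gram matrix of the encoding converges exponentially fast to `1 ⊗ ρᵀ`. -/
theorem exists_gram_encoding_close {A : Fin d → Matrix (Fin b) (Fin b) ℂ}
    (hA : IsErgodicKraus A ρ) (hpure : IsPureChainState fun _ n => wordState A ρ n) :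
    ∃ r C : ℝ, 0 < r ∧ r < 1 ∧ 0 ≤ C ∧ ∀ (n : ℕ) (p q : Fin b × Fin b),
      ‖((encoding A n)ᴴ * encoding A n - (1 : Matrix (Fin b) (Fin b) ℂ) ⊗ₖ ρᵀ) p q‖ ≤
        C * r ^ n := by
  obtain ⟨r, hr0, hr1, h⟩ := hA.exists_exponential_convergence (hA.eq_one_of_pure hpure)
  choose C hC using h
  let D : (Fin b × Fin b) × (Fin b × Fin b) → ℝ := fun s =>
    |C (single s.1.2 s.2.2 1) s.1.1 s.2.1|
  refine ⟨r, ∑ s, D s, hr0, hr1, Finset.sum_nonneg fun s _ => abs_nonneg _, fun n p q => ?_⟩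
  have h1 := hC (single p.2 q.2 1) p.1 q.1 n
  have h2 : (ρ * single p.2 q.2 (1 : ℂ)).trace * (1 : Matrix (Fin b) (Fin b) ℂ) p.1 q.1 =
      ((1 : Matrix (Fin b) (Fin b) ℂ) ⊗ₖ ρᵀ) p q := by
    rw [trace_mul_single, kroneckerMap_apply, transpose_apply]
    simp [mul_comm]
  rw [h2, ← gram_encoding_apply] at h1
  refine h1.trans (mul_le_mul_of_nonneg_right ?_ (by positivity))
  exact (le_abs_self _).trans
    (Finset.single_le_sum (f := D) (fun s _ => abs_nonneg _) (Finset.mem_univ (p, q)))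

theorem entanglementOfFormation_spins_le (hgen : Generates V ρ ω)
    (hinv : IsTranslationInvariant ω) (hω : ω ∈ chainStates d) (n : ℕ) :
    entanglementOfFormation (splitFirst (ω 1 (n + 1))) ≤
      entanglementOfFormation (spinMemoryState V ρ) := by
  have h := entanglementOfFormation_le_mul (K := encodingKraus (siteMatrix V) n) one_pos
    (by rw [sum_encodingKraus _ hgen.isErgodicKraus.unital, one_smul, sub_self]
        exact PosSemidef.zero)
    (isDensityMatrix_spinMemoryState hgen.coisometry hgen.density)
    (isDensityMatrix_splitFirst (hω.1 1 (n + 1)))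
    (by rw [hgen.eq_wordState hinv]; exact splitFirst_wordState V ρ n)
  rwa [one_mul] at h

theorem isSeparable_spins (hgen : Generates V ρ ω)
    (hinv : IsTranslationInvariant ω) (hω : ω ∈ chainStates d) (n : ℕ)
    (h : IsSeparable (spinMemoryState V ρ)) : IsSeparable (splitFirst (ω 1 (n + 1))) :=
  h.map (isDensityMatrix_splitFirst (hω.1 1 (n + 1))).2
    (by rw [hgen.eq_wordState hinv]; exact splitFirst_wordState V ρ n)

/-- For large `n` the spin-memory state is recovered from the state of `n + 1` spins, by an
operation that is trace-nonincreasing up to an exponentially small error. -/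
theorem exists_eventually_recovery (hpure : IsPureChainState ω)
    (hinv : IsTranslationInvariant ω) (hgen : Generates V ρ ω) :
    ∃ (r D : ℝ) (N : ℕ), 0 < r ∧ r < 1 ∧ 0 ≤ D ∧ ∀ n, N ≤ n →
      entanglementOfFormation (spinMemoryState V ρ) ≤
        (1 + D * r ^ n) * entanglementOfFormation (splitFirst (ω 1 (n + 1))) ∧
      (IsSeparable (splitFirst (ω 1 (n + 1))) → IsSeparable (spinMemoryState V ρ)) := by
  have hA := hgen.isErgodicKraus
  have hω := hgen.eq_wordState hinv
  have := hA.nonempty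
  obtain ⟨r, C, hr0, hr1, hC0, hC⟩ := exists_gram_encoding_close hA (hω ▸ hpure)
  obtain ⟨K, hK0, hK⟩ := exists_le_smul_of_close
    (PosDef.kronecker (PosDef.one (n := Fin b) (R := ℂ)) hA.posDef.transpose)
  have hlim : Filter.Tendsto (fun n => K * (C * r ^ n)) Filter.atTop (nhds 0) := by
    simpa using ((tendsto_pow_atTop_nhds_zero_of_lt_one hr0.le hr1).const_mul C).const_mul K
  obtain ⟨N, hN⟩ := Filter.eventually_atTop.1
    (hlim.eventually_le_const (show (0 : ℝ) < 1 / 2 by norm_num))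
  refine ⟨r, 2 * (K * C), N, hr0, hr1, by positivity, fun n hn => ?_⟩
  have hCr : 0 ≤ C * r ^ n := by positivity
  obtain ⟨hpd, hle⟩ := hK _ _ (isHermitian_conjTranspose_mul_self _) hCr (hC n) (hN n hn)
  obtain ⟨L, hL, hLκ⟩ := exists_recovery hgen.density hpd
  have hrec := hL (spinMemoryState V ρ)
  rw [← splitFirst_wordState] at hrec
  have hsplit : splitFirst (wordState (siteMatrix V) ρ (n + 1)) = splitFirst (ω 1 (n + 1)) := by
    rw [hω]
  rw [hsplit] at hrec
  have hρAB := isDensityMatrix_spinMemoryState hgen.coisometry hgen.density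
  refine ⟨?_, fun h => h.map hρAB.2 hrec⟩
  have hκ : 1 + 2 * (K * (C * r ^ n)) = 1 + 2 * (K * C) * r ^ n := by ring
  have hpos : 0 < 1 + 2 * (K * C) * r ^ n := by positivity
  rw [hκ] at hle
  exact entanglementOfFormation_le_mul hpos (hLκ _ hpos.le hle)
    (isDensityMatrix_splitFirst (hpure.1.1 1 (n + 1))) hρAB hrec

end Comparison

end SpinChain

end

theorem mainTheorem1 {d b : ℕ} (ω : SpinChain.LocalFamily d)
    (hpure : SpinChain.IsPureChainState ω)
    (hinv : SpinChain.IsTranslationInvariant ω)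
    (V : Matrix (Fin b) (Fin d × Fin b) ℂ) (ρ : Matrix (Fin b) (Fin b) ℂ)
    (hgen : SpinChain.Generates V ρ ω) :
    (∃ c r : ℝ, 0 < c ∧ 0 < r ∧ r < 1 ∧ ∀ n : ℕ,
      0 ≤ SpinChain.entanglementOfFormation (SpinChain.spinMemoryState V ρ) -
          SpinChain.entanglementOfFormation (SpinChain.splitFirst (ω 1 (n + 1))) ∧
      SpinChain.entanglementOfFormation (SpinChain.spinMemoryState V ρ) -
          SpinChain.entanglementOfFormation (SpinChain.splitFirst (ω 1 (n + 1))) ≤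
        c * r ^ (n + 1)) ∧
    ((∀ᶠ n : ℕ in Filter.atTop,
        SpinChain.IsEntangled (SpinChain.splitFirst (ω 1 (n + 1)))) ↔
      SpinChain.IsEntangled (SpinChain.spinMemoryState V ρ)) ∧
    ((∃ n : ℕ, SpinChain.IsEntangled (SpinChain.splitFirst (ω 1 (n + 1)))) ↔
      SpinChain.IsEntangled (SpinChain.spinMemoryState V ρ)) := by
  have hAB := SpinChain.isDensityMatrix_spinMemoryState hgen.coisometry hgen.density
  have hmono := SpinChain.entanglementOfFormation_spins_le hgen hinv hpure.1
  have hsep := SpinChain.isSeparable_spins hgen hinv hpure.1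
  obtain ⟨r, D, N, hr0, hr1, hD0, hN⟩ :=
    SpinChain.exists_eventually_recovery hpure hinv hgen
  have hfwd : (∃ n : ℕ, SpinChain.IsEntangled (SpinChain.splitFirst (ω 1 (n + 1)))) →
      SpinChain.IsEntangled (SpinChain.spinMemoryState V ρ) :=
    fun ⟨n, hn⟩ => ⟨hAB, fun h => hn.2 (hsep n h)⟩
  have hbwd : SpinChain.IsEntangled (SpinChain.spinMemoryState V ρ) → ∀ᶠ n : ℕ in Filter.atTop,
      SpinChain.IsEntangled (SpinChain.splitFirst (ω 1 (n + 1))) := fun h =>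
    Filter.eventually_atTop.2 ⟨N, fun n hn =>
      ⟨SpinChain.isDensityMatrix_splitFirst (hpure.1.1 1 (n + 1)),
        fun hs => h.2 ((hN n hn).2 hs)⟩⟩
  refine ⟨?_, ⟨fun h => hfwd h.exists, hbwd⟩, ⟨hfwd, fun h => (hbwd h).exists⟩⟩
  set E := SpinChain.entanglementOfFormation (SpinChain.spinMemoryState V ρ) with hE
  have hE0 : 0 ≤ E := SpinChain.entanglementOfFormation_nonneg _
  -- the second summand takes care of the finitely many `n < N`
  refine ⟨(D * E + E / r ^ N + 1) / r, r, by positivity, hr0, hr1, fun n =>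
    ⟨sub_nonneg.2 (hmono n), ?_⟩⟩
  have hc : (D * E + E / r ^ N + 1) / r * r ^ (n + 1) =
      D * E * r ^ n + E / r ^ N * r ^ n + r ^ n := by
    rw [pow_succ]
    field_simp
  have h1 : 0 ≤ D * E * r ^ n := by positivity
  have h2 : 0 ≤ E / r ^ N * r ^ n := by positivity
  have h3 : 0 < r ^ n := by positivity
  have h4 := SpinChain.entanglementOfFormation_nonneg (SpinChain.splitFirst (ω 1 (n + 1)))
  rw [hc]
  rcases le_or_gt N n with hn | hn
  · have h5 := (hN n hn).1
    have h6 : D * r ^ n * SpinChain.entanglementOfFormation (SpinChain.splitFirst (ω 1 (n + 1))) ≤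
        D * r ^ n * E := mul_le_mul_of_nonneg_left (hmono n) (by positivity)
    linarith
  · have h5 : E ≤ E / r ^ N * r ^ n := by
      rw [div_mul_eq_mul_div, le_div_iff₀ (by positivity)]
      exact mul_le_mul_of_nonneg_left (pow_le_pow_of_le_one hr0.le hr1.le hn.le) hE0
    linarith
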